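/- Let $d=8$ and let $\mathcal P$ be the set of the $64$ three-qubit Pauli operators $\sigma_1\otimes\sigma_2\otimes\sigma_3$ with $\sigma_i\in\{I,X,Y,Z\}$, acting on $\mathbb C^8$. A *maximal commuting Pauli class* is a set of $d-1=7$ pairwise commuting elements of $\mathcal P\setminus\{\mathbf I\}$. A *complete set of classes* consists of $d+1=9$ mutually disjoint maximal commuting Pauli classes. A set of mutually disjoint maximal commuting Pauli classes is *unextendible* if no maximal commuting Pauli class is contained in the set of those elements of $\mathcal P\setminus\{\mathbf I\}$ that lie in none of the classes. Two orthonormal bases $(a_i)$, $(b_j)$ of $\mathbb C^8$ are *unbiased* if $|\langle a_i,b_j\rangle|^2=1/8$ for all $i,j$; pairwise unbiased bases are called mutually unbiased bases (MUBs). A set of MUBs that are common eigenbases of mutually disjoint maximal commuting Pauli classes is *weakly unextendible* if no orthonormal basis that is a common eigenbasis of a maximal commuting Pauli class is unbiased with respect to all of them. **Theorem.** Let $\{\mathcal C_1,\dots,\mathcal C_9\}$ be any complete set of classes in dimension $d=8$ (in any numbering, so that $\mathcal C_1,\dots,\mathcal C_5$ are any five of its classes). There is exactly one maximal commuting Pauli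 class $\mathcal S$, different from $\mathcal C_1,\dots,\mathcal C_5$, with $\mathcal S\subset\mathcal C_1\cup\dots\cup\mathcal C_5$. Moreover, $\{\mathcal C_6,\mathcal C_7,\mathcal C_8,\mathcal C_9,\mathcal S\}$ is an unextendible set of five Pauli classes; each of these classes has a common orthonormal eigenbasis, and any such common eigenbases of the five classes form a weakly unextendible set of five MUBs in dimension $8$. -/

import Mathlib

open scoped Kronecker

noncomputable section

/-- The single-qubit Pauli matrices `I, X, Y, Z`, in this order. -/
def pauli : Fin 4 → Matrix (Fin 2) (Fin 2) ℂ :=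
  ![!![1, 0; 0, 1],
    !![0, 1; 1, 0],
    !![0, -Complex.I; Complex.I, 0],
    !![1, 0; 0, -1]]

/-- The index set of the computational basis of three qubits (eight elements, so `d = 8`). -/
abbrev ThreeQubits : Type := Fin 2 × Fin 2 × Fin 2

/-- The 64 three-qubit Pauli operators `σ ⊗ τ ⊗ ρ` with `σ, τ, ρ ∈ {I, X, Y, Z}`. -/
def threeQubitPaulis : Set (Matrix ThreeQubits ThreeQubits ℂ) :=
  {U | ∃ a b c : Fin 4, U = pauli a ⊗ₖ (pauli b ⊗ₖ pauli c)}

/-- `C` is a maximal commuting class of operators drawn from `𝒮`: it consists of exactly `d - 1`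
pairwise commuting non-identity operators of `𝒮`, where `d` is the dimension. -/
structure IsMaximalCommutingClass {ι : Type*} [Fintype ι] [DecidableEq ι]
    (𝒮 C : Set (Matrix ι ι ℂ)) : Prop where
  subset : C ⊆ 𝒮 \ {1}
  ncard_add_one : C.ncard + 1 = Fintype.card ι
  commute : ∀ U ∈ C, ∀ V ∈ C, Commute U V

/-- `C` is a family of mutually disjoint maximal commuting classes drawn from `𝒮`. -/
structure IsOperatorClasses {ι κ : Type*} [Fintype ι] [DecidableEq ι]
    (𝒮 : Set (Matrix ι ι ℂ)) (C : κ → Set (Matrix ι ι ℂ)) : Prop where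
  maximal : ∀ k, IsMaximalCommutingClass 𝒮 (C k)
  disjoint : ∀ j k, j ≠ k → Disjoint (C j) (C k)

/-- A complete set of classes: `d + 1` mutually disjoint maximal commuting classes. They contain
`(d + 1) (d - 1) = d ^ 2 - 1` operators in total, so when `𝒮` has `d ^ 2` elements,
one of them the identity, they partition `𝒮 \ {1}`. -/
structure IsCompleteOperatorClasses {ι κ : Type*} [Fintype ι] [DecidableEq ι] [Fintype κ]
    (𝒮 : Set (Matrix ι ι ℂ)) (C : κ → Set (Matrix ι ι ℂ)) : Prop
    extends IsOperatorClasses 𝒮 C where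
  card_eq : Fintype.card κ = Fintype.card ι + 1

/-- An unextendible set of operator classes: mutually disjoint maximal commuting classes such that
no maximal commuting class can be formed out of the remaining operators of `𝒮`. -/
structure IsUnextendibleClasses {ι κ : Type*} [Fintype ι] [DecidableEq ι]
    (𝒮 : Set (Matrix ι ι ℂ)) (C : κ → Set (Matrix ι ι ℂ)) : Prop
    extends IsOperatorClasses 𝒮 C where
  not_exists : ¬ ∃ T : Set (Matrix ι ι ℂ),
    IsMaximalCommutingClass 𝒮 T ∧ T ⊆ 𝒮 \ ({1} ∪ ⋃ k, C k)

/-- The orthonormal basis `b` of `ℂ^d` is a common eigenbasis of all operators in `C`. -/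
def IsCommonEigenbasis {ι : Type*} [Fintype ι] (C : Set (Matrix ι ι ℂ))
    (b : OrthonormalBasis ι ℂ (EuclideanSpace ℂ ι)) : Prop :=
  ∀ U ∈ C, ∀ i, ∃ l : ℂ, Matrix.mulVec U (b i) = l • (b i : ι → ℂ)

/-- Two orthonormal bases of `ℂ^d` are unbiased: `|⟨a_i, b_j⟩|^2 = 1 / d` for all `i, j`. -/
def AreUnbiased {ι : Type*} [Fintype ι]
    (a b : OrthonormalBasis ι ℂ (EuclideanSpace ℂ ι)) : Prop :=
  ∀ i j, ‖inner ℂ (a i) (b j)‖ ^ 2 = 1 / (Fintype.card ι : ℝ)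

/-- The bases `B k` are mutually unbiased. -/
def AreMUBs {ι κ : Type*} [Fintype ι]
    (B : κ → OrthonormalBasis ι ℂ (EuclideanSpace ℂ ι)) : Prop :=
  ∀ j k, j ≠ k → AreUnbiased (B j) (B k)

/-- A weakly unextendible set of MUBs (with respect to `𝒮`): mutually unbiased bases, realized as
common eigenbases of operator classes drawn from `𝒮`, such that no further basis, unbiased to all
of them, is a common eigenbasis of a maximal commuting class of operators in `𝒮`. -/
structure IsWeaklyUnextendibleMUBs {ι κ : Type*} [Fintype ι] [DecidableEq ι]
    (𝒮 : Set (Matrix ι ι ℂ))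
    (B : κ → OrthonormalBasis ι ℂ (EuclideanSpace ℂ ι)) : Prop where
  mub : AreMUBs B
  realized : ∃ C : κ → Set (Matrix ι ι ℂ),
    IsOperatorClasses 𝒮 C ∧ ∀ k, IsCommonEigenbasis (C k) (B k)
  not_exists : ¬ ∃ (T : Set (Matrix ι ι ℂ)) (b : OrthonormalBasis ι ℂ (EuclideanSpace ℂ ι)),
    IsMaximalCommutingClass 𝒮 T ∧ IsCommonEigenbasis T b ∧ ∀ k, AreUnbiased b (B k)

/-- `T` is a new maximal commuting class of three-qubit Pauli operators that can be formed
from the elements of the union of the classes `D k`: it is different from each of them. -/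
structure IsNewPauliClass {κ : Type*} (D : κ → Set (Matrix ThreeQubits ThreeQubits ℂ))
    (T : Set (Matrix ThreeQubits ThreeQubits ℂ)) : Prop where
  maximal : IsMaximalCommutingClass threeQubitPaulis T
  subset : T ⊆ ⋃ k, D k
  ne : ∀ k, T ≠ D k

end

/-! Up to phases the Pauli operators form a six-dimensional symplectic space over the field of two
elements, and commuting means orthogonal. Maximal commuting classes are the Lagrangians without zero
(`isMaximalCommutingClass_iff`), and a complete set of classes is a spread: nine Lagrangians that
partition the 63 nonzero vectors.

Let `S` be a Lagrangian covered by five disjoint ones and different from each. By pigeonhole two of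
its seven nonzero vectors share some `U k`; the other four form a coset of the resulting plane and
must fall into the other four Lagrangians, one in each (`IsNewLagrangian.exists_line`). Hence `S`
meets all five. In coordinates where three of the five are `v = 0`, `u = 0`, `u = v`, it is spanned
by `(x, 0)`, `(0, y)`, `(z, z)`; the other two, and a sixth member of the spread, are graphs of
symmetric matrices. Existence and uniqueness of `S` become a finite check over pairs of such
matrices (`existsUnique_isNewLagrangian`).

A Lagrangian disjoint from the last four members of the spread is covered by the first five, so it
is `S` or one of the five, and `S` meets each of these: this is unextendibility. It passes to bases
because Pauli expectations determine overlaps (`sum_expectation_mul`), so that eigenbases are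
unbiased exactly when their classes are disjoint. -/

/-! ### Six pairwise transversal Lagrangians in coordinates -/

/-- Vectors of the three-dimensional binary space. -/
abbrev BinTriple : Type := ZMod 2 × ZMod 2 × ZMod 2

/-- The standard dot product of binary triples. -/
def tripleDot (x y : BinTriple) : ZMod 2 := x.1 * y.1 + x.2.1 * y.2.1 + x.2.2 * y.2.2

/-- Symmetric `3 × 3` matrices over `ZMod 2`: the diagonal and the entries `01, 02, 12`. -/
abbrev BinSym : Type := BinTriple × BinTriple

/-- Apply a symmetric matrix to a vector. -/
def BinSym.apply (B : BinSym) (y : BinTriple) : BinTriple :=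
  (tripleDot (B.1.1, B.2.1, B.2.2.1) y, tripleDot (B.2.1, B.1.2.1, B.2.2.2) y,
    tripleDot (B.2.2.1, B.2.2.2, B.1.2.2) y)

/-- The identity matrix. -/
def BinSym.id : BinSym := ((1, 1, 1), 0)

/-- The graphs of `B` and `C` meet only in zero. -/
def BinSym.Transversal (B C : BinSym) : Prop := ∀ y : BinTriple, y ≠ 0 → B.apply y ≠ C.apply y

instance (B C : BinSym) : Decidable (B.Transversal C) := by
  unfold BinSym.Transversal; infer_instance

/-- `B` is transversal to zero and the identity. -/
def BinSym.IsSpreadElement (B : BinSym) : Prop :=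
  B.Transversal 0 ∧ B.Transversal BinSym.id

instance (B : BinSym) : Decidable B.IsSpreadElement := by
  unfold BinSym.IsSpreadElement; infer_instance

/-- `(u, v)` lies on one of the Lagrangians `v = 0`, `u = 0`, `u = v`, `u = B v`, `u = C v`. -/
def InFiveGraphs (B C : BinSym) (u v : BinTriple) : Prop :=
  v = 0 ∨ u = 0 ∨ u = v ∨ u = B.apply v ∨ u = C.apply v

instance (B C : BinSym) (u v : BinTriple) : Decidable (InFiveGraphs B C u v) := by
  unfold InFiveGraphs; infer_instance

/-- The vectors `(x, 0)`, `(0, y)`, `(z, z)` generate a Lagrangian covered by the five. -/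
def SpansNewLagrangian (B C : BinSym) (x y z : BinTriple) : Prop :=
  x ≠ 0 ∧ y ≠ 0 ∧ z ≠ 0 ∧ tripleDot x y = 0 ∧ tripleDot x z = 0 ∧ tripleDot y z = 0 ∧
  ¬ (x = z ∧ y = z) ∧ InFiveGraphs B C x y ∧ InFiveGraphs B C (x + z) z ∧
  InFiveGraphs B C z (y + z) ∧ InFiveGraphs B C (x + z) (y + z)

instance (B C : BinSym) (x y z : BinTriple) : Decidable (SpansNewLagrangian B C x y z) := by
  unfold SpansNewLagrangian; infer_instance

/-- `(u, v)` is a combination of `(x, 0)`, `(0, y)`, `(z, z)`. -/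
def InTripleSpan (x y z u v : BinTriple) : Prop :=
  ∃ a b c : ZMod 2, u = a • x + c • z ∧ v = b • y + c • z

instance (x y z u v : BinTriple) : Decidable (InTripleSpan x y z u v) := by
  unfold InTripleSpan; infer_instance

/-- Some graph is transversal to those of `0`, `1`, `B`, `C`. -/
def HasFurtherGraph (B C : BinSym) : Prop :=
  ∃ D : BinSym, D.IsSpreadElement ∧ B.Transversal D ∧ C.Transversal D

instance (B C : BinSym) : Decidable (HasFurtherGraph B C) := by
  unfold HasFurtherGraph; infer_instance

-- Finite check over 64 matrices for each of `B` and `C`. Hypotheses are interleaved with the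
-- quantifiers so that inadmissible pairs are discarded early.
set_option synthInstance.maxHeartbeats 400000 in
set_option synthInstance.maxSize 4000 in
theorem exists_spansNewLagrangian : ∀ B : BinSym, B.IsSpreadElement →
    ∀ C : BinSym, C.IsSpreadElement → B.Transversal C → HasFurtherGraph B C →
    ∃ x y z : BinTriple, SpansNewLagrangian B C x y z := by
  decide +kernel

-- Uniqueness concerns the span and not the generators: when the plane shared with one of the five
-- lies in one of the first three, its generator can be chosen in several ways.
set_option synthInstance.maxHeartbeats 400000 in
set_option synthInstance.maxSize 4000 in
theorem spansNewLagrangian_unique : ∀ B : BinSym, B.IsSpreadElement →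
    ∀ C : BinSym, C.IsSpreadElement → B.Transversal C → HasFurtherGraph B C →
    ∀ x y z : BinTriple, SpansNewLagrangian B C x y z →
    ∀ x' y' z' : BinTriple, SpansNewLagrangian B C x' y' z' →
    InTripleSpan x y z x' 0 ∧ InTripleSpan x y z 0 y' ∧ InTripleSpan x y z z' z' := by
  decide +kernel

/-- A nondegenerate symmetric form on a three-dimensional binary space has an orthonormal basis. -/
theorem exists_orthonormal_triples : ∀ G : BinSym, G.Transversal 0 →
    ∃ x : BinTriple, tripleDot x (G.apply x) = 1 ∧
    ∃ y : BinTriple, tripleDot y (G.apply y) = 1 ∧ tripleDot x (G.apply y) = 0 ∧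
    ∃ z : BinTriple, tripleDot z (G.apply z) = 1 ∧ tripleDot x (G.apply z) = 0 ∧
      tripleDot y (G.apply z) = 0 := by
  -- The odd dimension is essential: a nondegenerate form cannot be alternating there, and a
  -- nondegenerate non-alternating symmetric form over two elements has an orthonormal basis.
  decide +kernel

/-! ### Lagrangians of a six-dimensional binary symplectic space -/

/-- `ω` is a symplectic form on a binary space of dimension six. -/
structure IsSymplecticSix {V : Type*} [AddCommGroup V] [Module (ZMod 2) V]
    (ω : LinearMap.BilinForm (ZMod 2) V) : Prop where
  finrank_eq : Module.finrank (ZMod 2) V = 6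
  nondegenerate : ω.Nondegenerate
  alt : ω.IsAlt

/-- A totally isotropic subspace of dimension three. -/
structure IsLagrangian {V : Type*} [AddCommGroup V] [Module (ZMod 2) V]
    (ω : LinearMap.BilinForm (ZMod 2) V) (W : Submodule (ZMod 2) V) : Prop where
  isotropic : ∀ u ∈ W, ∀ v ∈ W, ω u v = 0
  finrank_eq : Module.finrank (ZMod 2) W = 3

theorem finrank_binTriple : Module.finrank (ZMod 2) BinTriple = 3 := by simp

section Lagrangian

variable {V : Type*} [AddCommGroup V] [Module (ZMod 2) V]
  {ω : LinearMap.BilinForm (ZMod 2) V}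

theorem binary_add_self (v : V) : v + v = 0 := by
  rw [← two_smul (ZMod 2) v, show (2 : ZMod 2) = 0 from rfl, zero_smul]

theorem binary_sub_eq_add (u v : V) : u - v = u + v := by
  rw [sub_eq_iff_eq_add, add_assoc, binary_add_self, add_zero]

theorem binary_eq_of_add_eq_zero {u v : V} (h : u + v = 0) : u = v := by
  rwa [← binary_sub_eq_add, sub_eq_zero] at h

theorem zmod_two_cases (a : ZMod 2) : a = 0 ∨ a = 1 := by revert a; decide

theorem IsSymplecticSix.finite (hω : IsSymplecticSix ω) : Module.Finite (ZMod 2) V :=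
  Module.finite_of_finrank_pos (by rw [hω.finrank_eq]; norm_num)

theorem IsSymplecticSix.symm (hω : IsSymplecticSix ω) (u v : V) : ω u v = ω v u := by
  rw [← hω.alt.neg_eq, ZMod.neg_eq_self_mod_two]

theorem IsSymplecticSix.finrank_le_three (hω : IsSymplecticSix ω) {W : Submodule (ZMod 2) V}
    (hW : ∀ u ∈ W, ∀ v ∈ W, ω u v = 0) : Module.finrank (ZMod 2) W ≤ 3 := by
  have := hω.finite
  have h1 : W ≤ ω.orthogonal W := fun v hv u hu => hW u hu v hv
  have h2 := Submodule.finrank_mono h1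
  have h3 := LinearMap.BilinForm.finrank_orthogonal hω.nondegenerate W
  rw [hω.finrank_eq] at h3
  omega

theorem IsLagrangian.mem_of_orthogonal {W : Submodule (ZMod 2) V} (hω : IsSymplecticSix ω)
    (hW : IsLagrangian ω W) {v : V} (hv : ∀ u ∈ W, ω u v = 0) : v ∈ W := by
  have := hω.finite
  have h1 : W ≤ ω.orthogonal W := fun v hv u hu => hW.isotropic u hu v hv
  have h3 := LinearMap.BilinForm.finrank_orthogonal hω.nondegenerate W
  rw [hω.finrank_eq, hW.finrank_eq] at h3
  rw [Submodule.eq_of_le_of_finrank_eq h1 (by rw [hW.finrank_eq, h3])]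
  exact hv

theorem IsLagrangian.isCompl {U W : Submodule (ZMod 2) V} (hω : IsSymplecticSix ω)
    (hU : IsLagrangian ω U) (hW : IsLagrangian ω W) (h : Disjoint U W) : IsCompl U W := by
  have := hω.finite
  refine ⟨h, codisjoint_iff.2 ?_⟩
  apply Submodule.eq_top_of_finrank_eq
  have h1 := Submodule.finrank_sup_add_finrank_inf_eq U W
  rw [h.eq_bot, finrank_bot, hU.finrank_eq, hW.finrank_eq] at h1
  rw [hω.finrank_eq]
  omega

theorem IsLagrangian.exists_equiv {U : Submodule (ZMod 2) V} (hω : IsSymplecticSix ω)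
    (hU : IsLagrangian ω U) : Nonempty (BinTriple ≃ₗ[ZMod 2] U) := by
  have := hω.finite
  exact ⟨LinearEquiv.ofFinrankEq _ _ (by rw [hU.finrank_eq, finrank_binTriple])⟩

/-- Project along `W` onto `U`. -/
theorem IsLagrangian.exists_projection {U W : Submodule (ZMod 2) V} (hω : IsSymplecticSix ω)
    (hU : IsLagrangian ω U) (hW : IsLagrangian ω W) (h : Disjoint U W)
    (g : BinTriple →ₗ[ZMod 2] V) :
    ∃ b : BinTriple →ₗ[ZMod 2] V, (∀ y, b y ∈ U) ∧ ∀ y, b y + g y ∈ W := by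
  have hc := hU.isCompl hω hW h
  refine ⟨U.subtype ∘ₗ (U.projectionOnto W hc) ∘ₗ g, fun y => by simp, fun y => ?_⟩
  rw [add_comm, ← binary_sub_eq_add]
  refine (SetLike.ext_iff.1 (Submodule.ker_projectionOnto hc) _).1 ?_
  rw [LinearMap.mem_ker, map_sub]
  exact sub_eq_zero.2 (Submodule.projectionOnto_apply_left hc _).symm

/-- The linear combination of three vectors. -/
def tripleComb (a b c : V) : BinTriple →ₗ[ZMod 2] V where
  toFun t := t.1 • a + t.2.1 • b + t.2.2 • c
  map_add' s t := by simp only [Prod.fst_add, Prod.snd_add]; module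
  map_smul' r t := by
    simp only [Prod.smul_fst, Prod.smul_snd, smul_eq_mul, RingHom.id_apply]; module

theorem tripleComb_apply (a b c : V) (t : BinTriple) :
    tripleComb a b c t = t.1 • a + t.2.1 • b + t.2.2 • c := rfl

theorem binTriple_eq (x : BinTriple) :
    x = x.1 • ((1, 0, 0) : BinTriple) + x.2.1 • ((0, 1, 0) : BinTriple)
      + x.2.2 • ((0, 0, 1) : BinTriple) := by
  ext <;> simp

theorem exists_binSym {β : BinTriple → BinTriple → ZMod 2}
    (hadd : ∀ x y z, β (x + y) z = β x z + β y z) (hsmul : ∀ a x z, β (a • x) z = a * β x z)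
    (hsymm : ∀ x y, β x y = β y x) :
    ∃ G : BinSym, ∀ x y, β x y = tripleDot x (G.apply y) := by
  have hr : ∀ x y z, β z (x + y) = β z x + β z y := fun x y z => by
    rw [hsymm, hadd, hsymm x, hsymm y]
  have hr2 : ∀ a x z, β z (a • x) = a * β z x := fun a x z => by rw [hsymm, hsmul, hsymm x]
  refine ⟨((β (1,0,0) (1,0,0), β (0,1,0) (0,1,0), β (0,0,1) (0,0,1)),
    (β (1,0,0) (0,1,0), β (1,0,0) (0,0,1), β (0,1,0) (0,0,1))), fun x y => ?_⟩
  conv_lhs => rw [binTriple_eq x, binTriple_eq y]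
  simp only [hadd, hsmul, hr, hr2, hsymm (0,1,0) (1,0,0), hsymm (0,0,1) (1,0,0),
    hsymm (0,0,1) (0,1,0), tripleDot, BinSym.apply]
  ring

theorem tripleDot_comm (x y : BinTriple) : tripleDot x y = tripleDot y x := by
  simp only [tripleDot]; ring

theorem tripleDot_add_left (x y z : BinTriple) :
    tripleDot (x + y) z = tripleDot x z + tripleDot y z := by
  simp only [tripleDot, Prod.fst_add, Prod.snd_add]; ring

theorem tripleDot_smul_left (a : ZMod 2) (x z : BinTriple) :
    tripleDot (a • x) z = a * tripleDot x z := by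
  simp only [tripleDot, Prod.smul_fst, Prod.smul_snd, smul_eq_mul]; ring

theorem tripleDot_add_right (x y z : BinTriple) :
    tripleDot x (y + z) = tripleDot x y + tripleDot x z := by
  simp only [tripleDot, Prod.fst_add, Prod.snd_add]; ring

theorem tripleDot_smul_right (a : ZMod 2) (x z : BinTriple) :
    tripleDot x (a • z) = a * tripleDot x z := by
  simp only [tripleDot, Prod.smul_fst, Prod.smul_snd, smul_eq_mul]; ring

theorem eq_zero_of_tripleDot {x : BinTriple} (h : ∀ y, tripleDot x y = 0) : x = 0 := by
  have h1 := h (1, 0, 0)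
  have h2 := h (0, 1, 0)
  have h3 := h (0, 0, 1)
  simp only [tripleDot, mul_one, mul_zero, add_zero, zero_add] at h1 h2 h3
  ext <;> simp [h1, h2, h3]

theorem BinSym.zero_apply (y : BinTriple) : (0 : BinSym).apply y = 0 := by
  simp [BinSym.apply, tripleDot]

theorem BinSym.id_apply (y : BinTriple) : BinSym.id.apply y = y := by
  simp [BinSym.apply, tripleDot, BinSym.id]

/-- Dual coordinates on two transversal Lagrangians. -/
structure IsLagrangianFrame (ω : LinearMap.BilinForm (ZMod 2) V) (U W : Submodule (ZMod 2) V)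
    (e f : BinTriple →ₗ[ZMod 2] V) : Prop where
  left_mem : ∀ x, e x ∈ U
  right_mem : ∀ x, f x ∈ W
  dot : ∀ x y, ω (e x) (f y) = tripleDot x y

/-- `U₂` is the graph of an isomorphism from `U₁` to `U₀`, which turns the pairing of `U₀` with `U₁`
into a bilinear form on `U₁`. Isotropy of `U₂` makes this form symmetric and disjointness makes it
nondegenerate; an orthonormal basis for it gives dual coordinates. -/
theorem exists_frame {U₀ U₁ U₂ : Submodule (ZMod 2) V} (hω : IsSymplecticSix ω)
    (h₀ : IsLagrangian ω U₀) (h₁ : IsLagrangian ω U₁) (h₂ : IsLagrangian ω U₂)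
    (h₀₁ : Disjoint U₀ U₁) (h₀₂ : Disjoint U₀ U₂) (h₁₂ : Disjoint U₁ U₂) :
    ∃ e f : BinTriple →ₗ[ZMod 2] V, IsLagrangianFrame ω U₀ U₁ e f ∧ ∀ x, e x + f x ∈ U₂ := by
  obtain ⟨φ⟩ := h₁.exists_equiv hω
  set g : BinTriple →ₗ[ZMod 2] V := U₁.subtype ∘ₗ φ.toLinearMap with hg
  have hg1 : ∀ y, g y ∈ U₁ := fun y => by simp [hg]
  have hginj : ∀ y, g y = 0 → y = 0 := fun y hy => by simpa [hg] using hy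
  have hgsurj : ∀ v ∈ U₁, ∃ y, g y = v := fun v hv => ⟨φ.symm ⟨v, hv⟩, by simp [hg]⟩
  obtain ⟨a, ha0, ha2⟩ := h₀.exists_projection hω h₂ h₀₂ g
  have hsymm : ∀ x y, ω (a x) (g y) = ω (a y) (g x) := fun x y => by
    have := h₂.isotropic _ (ha2 x) _ (ha2 y)
    simp only [map_add, LinearMap.add_apply, h₀.isotropic _ (ha0 x) _ (ha0 y),
      h₁.isotropic _ (hg1 x) _ (hg1 y), zero_add, add_zero] at this
    rw [hω.symm (g x)] at this
    rw [add_comm] at this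
    exact binary_eq_of_add_eq_zero this
  obtain ⟨G, hG⟩ := exists_binSym (β := fun x y => ω (a x) (g y))
    (fun x y z => by simp) (fun r x z => by simp) hsymm
  have hnd : G.Transversal 0 := by
    intro y hy0 hy
    apply hy0
    rw [BinSym.zero_apply] at hy
    have h1 : ∀ x, ω (g x) (a y) = 0 := fun x => by
      rw [hω.symm, hsymm, hG, hy]; simp [tripleDot]
    have h2 : a y ∈ U₁ := h₁.mem_of_orthogonal hω fun u hu => by
      obtain ⟨x, rfl⟩ := hgsurj u hu
      exact h1 x
    have h3 : a y = 0 := Submodule.disjoint_def.1 h₀₁ _ (ha0 y) h2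
    have h4 := ha2 y
    rw [h3, zero_add] at h4
    exact hginj y (Submodule.disjoint_def.1 h₁₂ _ (hg1 y) h4)
  obtain ⟨x, hxx, y, hyy, hxy, z, hzz, hxz, hyz⟩ := exists_orthonormal_triples G hnd
  rw [← hG] at hxx hyy hxy hzz hxz hyz
  have hyx := hxy
  have hzx := hxz
  have hzy := hyz
  rw [hsymm] at hyx hzx hzy
  refine ⟨a ∘ₗ tripleComb x y z, g ∘ₗ tripleComb x y z, ⟨fun t => ha0 _, fun t => hg1 _,
    fun s t => ?_⟩, fun t => ha2 _⟩
  simp only [LinearMap.comp_apply, tripleComb_apply, map_add, map_smul, LinearMap.add_apply,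
    LinearMap.smul_apply, hxx, hyy, hxy, hzz, hxz, hyz, hyx, hzx, hzy, tripleDot, smul_eq_mul]
  ring

section Frame

variable {U₀ U₁ W : Submodule (ZMod 2) V} {e f : BinTriple →ₗ[ZMod 2] V}

theorem IsLagrangianFrame.left_injective (h : IsLagrangianFrame ω U₀ U₁ e f) :
    Function.Injective e :=
  (injective_iff_map_eq_zero e).2 fun x hx => eq_zero_of_tripleDot fun y => by
    rw [← h.dot, hx, map_zero, LinearMap.zero_apply]

theorem IsLagrangianFrame.right_injective (h : IsLagrangianFrame ω U₀ U₁ e f) :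
    Function.Injective f :=
  (injective_iff_map_eq_zero f).2 fun x hx => eq_zero_of_tripleDot fun y => by
    rw [tripleDot_comm, ← h.dot, hx, map_zero]

theorem IsLagrangian.exists_of_injective {g : BinTriple →ₗ[ZMod 2] V} (hω : IsSymplecticSix ω)
    (hW : IsLagrangian ω W) (hg : Function.Injective g) (hmem : ∀ x, g x ∈ W) {v : V}
    (hv : v ∈ W) : ∃ x, g x = v := by
  have := hω.finite
  have h1 : LinearMap.range g ≤ W := by rintro _ ⟨x, rfl⟩; exact hmem x
  have h2 := Submodule.eq_of_le_of_finrank_eq h1 (by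
    rw [LinearMap.finrank_range_of_inj hg, hW.finrank_eq, finrank_binTriple])
  rw [← h2] at hv
  exact hv

theorem IsLagrangianFrame.exists_coordinates (h : IsLagrangianFrame ω U₀ U₁ e f)
    (hω : IsSymplecticSix ω) (h₀ : IsLagrangian ω U₀) (h₁ : IsLagrangian ω U₁)
    (h₀₁ : Disjoint U₀ U₁) (v : V) : ∃ x y, v = e x + f y := by
  have hv : v ∈ U₀ ⊔ U₁ := by rw [(h₀.isCompl hω h₁ h₀₁).sup_eq_top]; trivial
  obtain ⟨u, hu, w, hw, rfl⟩ := Submodule.mem_sup.1 hv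
  obtain ⟨x, rfl⟩ := h₀.exists_of_injective hω h.left_injective h.left_mem hu
  obtain ⟨y, rfl⟩ := h₁.exists_of_injective hω h.right_injective h.right_mem hw
  exact ⟨x, y, rfl⟩

/-- A complement of `U₀` is the graph of a map from `U₁` to `U₀`, and its isotropy is the symmetry
of the matrix of that map. -/
theorem IsLagrangianFrame.exists_graph (h : IsLagrangianFrame ω U₀ U₁ e f)
    (hω : IsSymplecticSix ω) (h₀ : IsLagrangian ω U₀) (h₁ : IsLagrangian ω U₁)
    (h₀₁ : Disjoint U₀ U₁) (hW : IsLagrangian ω W) (h₀W : Disjoint U₀ W) :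
    ∃ B : BinSym, ∀ y, e (B.apply y) + f y ∈ W := by
  obtain ⟨b, hb0, hbW⟩ := h₀.exists_projection hω hW h₀W f
  have hsymm : ∀ x y, ω (b x) (f y) = ω (b y) (f x) := fun x y => by
    have := hW.isotropic _ (hbW x) _ (hbW y)
    simp only [map_add, LinearMap.add_apply, h₀.isotropic _ (hb0 x) _ (hb0 y),
      h₁.isotropic _ (h.right_mem x) _ (h.right_mem y), zero_add, add_zero] at this
    rw [hω.symm (f x), add_comm] at this
    exact binary_eq_of_add_eq_zero this
  obtain ⟨B, hB⟩ := exists_binSym (β := fun x y => ω (b x) (f y))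
    (fun x y z => by simp) (fun r x z => by simp) hsymm
  refine ⟨B, fun y => ?_⟩
  -- Both vectors have the same pairings with `U₁`, so their difference lies in `U₁` by maximality;
  -- it also lies in `U₀`, hence vanishes.
  have hd : b y - e (B.apply y) ∈ U₁ := h₁.mem_of_orthogonal hω fun u hu => by
    obtain ⟨x, rfl⟩ := h₁.exists_of_injective hω h.right_injective h.right_mem hu
    rw [hω.symm, map_sub, LinearMap.sub_apply, h.dot, hsymm, hB, tripleDot_comm, sub_self]
  have h0 := Submodule.disjoint_def.1 h₀₁ _ (U₀.sub_mem (hb0 y) (h.left_mem _)) hd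
  rw [← sub_eq_zero.1 h0]
  exact hbW y

theorem IsLagrangianFrame.mem_graph_iff (h : IsLagrangianFrame ω U₀ U₁ e f)
    (h₀W : Disjoint U₀ W) {B : BinSym} (hB : ∀ y, e (B.apply y) + f y ∈ W) (x y : BinTriple) :
    e x + f y ∈ W ↔ x = B.apply y := by
  refine ⟨fun hm => ?_, fun hx => hx ▸ hB y⟩
  have h1 := W.sub_mem hm (hB y)
  rw [add_sub_add_right_eq_sub, ← map_sub] at h1
  have h2 := Submodule.disjoint_def.1 h₀W _ (h.left_mem _) h1
  exact sub_eq_zero.1 ((injective_iff_map_eq_zero e).1 h.left_injective _ h2)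

theorem IsLagrangianFrame.mem_left_iff (h : IsLagrangianFrame ω U₀ U₁ e f)
    (h₀₁ : Disjoint U₀ U₁) (x y : BinTriple) : e x + f y ∈ U₀ ↔ y = 0 := by
  refine ⟨fun hm => ?_, fun hy => by simpa [hy] using h.left_mem x⟩
  rw [U₀.add_mem_iff_right (h.left_mem x)] at hm
  exact (injective_iff_map_eq_zero f).1 h.right_injective _
    (Submodule.disjoint_def.1 h₀₁ _ hm (h.right_mem y))

theorem IsLagrangianFrame.transversal {W' : Submodule (ZMod 2) V}
    (h : IsLagrangianFrame ω U₀ U₁ e f) (h₀₁ : Disjoint U₀ U₁)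
    (hd : Disjoint W W') {B C : BinSym} (hB : ∀ y, e (B.apply y) + f y ∈ W)
    (hC : ∀ y, e (C.apply y) + f y ∈ W') : B.Transversal C := by
  intro y hy hBC
  have h1 := hB y
  have h2 := hC y
  rw [← hBC] at h2
  have h3 := Submodule.disjoint_def.1 hd _ h1 h2
  apply hy
  rw [← h.mem_left_iff h₀₁ (B.apply y), h3]
  exact U₀.zero_mem

theorem IsLagrangianFrame.form_eq (h : IsLagrangianFrame ω U₀ U₁ e f)
    (hω : IsSymplecticSix ω) (h₀ : IsLagrangian ω U₀) (h₁ : IsLagrangian ω U₁)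
    (x y x' y' : BinTriple) :
    ω (e x + f y) (e x' + f y') = tripleDot x y' + tripleDot x' y := by
  simp only [map_add, LinearMap.add_apply, h.dot, h₀.isotropic _ (h.left_mem x) _ (h.left_mem x'),
    h₁.isotropic _ (h.right_mem y) _ (h.right_mem y'), hω.symm (f y)]
  ring

end Frame

end Lagrangian

/-! ### Lagrangians covered by five disjoint Lagrangians -/

section NewLagrangian

variable {V : Type*} [AddCommGroup V] [Module (ZMod 2) V]
  {ω : LinearMap.BilinForm (ZMod 2) V}

/-- A Lagrangian covered by the Lagrangians `U k` and different from each of them. -/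
structure IsNewLagrangian {κ : Type*} (ω : LinearMap.BilinForm (ZMod 2) V)
    (U : κ → Submodule (ZMod 2) V) (S : Submodule (ZMod 2) V) : Prop where
  lagrangian : IsLagrangian ω S
  covered : ∀ v ∈ S, ∃ k, v ∈ U k
  ne : ∀ k, S ≠ U k

/-- A new Lagrangian meets one of five disjoint Lagrangians in a line and each other in a point. -/
theorem IsNewLagrangian.exists_line {U : Fin 5 → Submodule (ZMod 2) V}
    {S : Submodule (ZMod 2) V} (hω : IsSymplecticSix ω) (hU : ∀ k, IsLagrangian ω (U k))
    (hd : ∀ j k, j ≠ k → Disjoint (U j) (U k)) (hS : IsNewLagrangian ω U S) :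
    ∃ (k : Fin 5) (a b c : V), a ∈ S ∧ a ∈ U k ∧ b ∈ S ∧ b ∈ U k ∧ a ≠ 0 ∧ b ≠ 0 ∧ a ≠ b ∧
      c ∈ S ∧ c ∉ U k ∧ ∀ j, j ≠ k → ∃ l, l ∈ S ∧ l ∈ U k ∧ c + l ∈ U j := by
  have := hω.finite
  obtain ⟨φ⟩ := hS.lagrangian.exists_equiv hω
  choose col hcol using fun v : S => hS.covered v v.2
  obtain ⟨s, t, hst, hcst⟩ := Fintype.exists_ne_map_eq_of_card_lt
    (fun t : {t : BinTriple // t ≠ 0} => col (φ t)) (by decide)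
  set k := col (φ s) with hk
  have hs : (φ s : V) ∈ U k := hcol _
  have ht : (φ t : V) ∈ U k := by rw [hk, show col (φ s) = col (φ t) from hcst]; exact hcol _
  obtain ⟨c, hcS, hck⟩ : ∃ c ∈ S, c ∉ U k := by
    by_contra! hle
    exact hS.ne k (Submodule.eq_of_le_of_finrank_eq hle
      (by rw [hS.lagrangian.finrank_eq, (hU k).finrank_eq]))
  have ha0 : (φ s : V) ≠ 0 := by simpa using s.2
  have hb0 : (φ t : V) ≠ 0 := by simpa using t.2
  have hab : (φ s : V) ≠ φ t := fun h => hst (Subtype.ext (φ.injective (Subtype.ext h)))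
  have haS : (φ s : V) ∈ S := (φ s).2
  have hbS : (φ t : V) ∈ S := (φ t).2
  clear_value k
  generalize (φ s : V) = a at *
  generalize (φ t : V) = b at *
  refine ⟨k, a, b, c, haS, hs, hbS, ht, ha0, hb0, hab, hcS, hck, fun j hj => ?_⟩
  let l : Fin 4 → V := ![0, a, b, a + b]
  have hlS : ∀ i, l i ∈ S := by
    intro i
    fin_cases i
    exacts [S.zero_mem, haS, hbS, S.add_mem haS hbS]
  have hlk : ∀ i, l i ∈ U k := by
    intro i
    fin_cases i
    exacts [(U k).zero_mem, hs, ht, (U k).add_mem hs ht]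
  have hlinj : Function.Injective l := by
    have hab0 : a + b ≠ 0 := fun h => hab (binary_eq_of_add_eq_zero h)
    intro i j
    fin_cases i <;> fin_cases j <;>
      simp [l, ha0, hb0, hab, hab0, ha0.symm, hb0.symm, hab.symm, hab0.symm]
  have hcol' : ∀ i, ∃ j : {j // j ≠ k}, c + l i ∈ U j := fun i => by
    obtain ⟨j, hj⟩ := hS.covered _ (S.add_mem hcS (hlS i))
    exact ⟨⟨j, fun h => hck (((U k).add_mem_iff_left (hlk i)).1 (h ▸ hj))⟩, hj⟩
  choose m hm using hcol'
  -- Two vectors of the coset of `c` in the same `U j` would have their difference in both `U j` and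
  -- `U k`. So four vectors occupy distinct members among four, and each member is hit.
  have hminj : Function.Injective m := fun i i' h => hlinj (by
    have h1 := (U (m i)).sub_mem (hm i) (by rw [h]; exact hm i')
    rw [add_sub_add_left_eq_sub] at h1
    exact sub_eq_zero.1 (Submodule.disjoint_def.1 (hd _ _ (m i).2) _ h1
      ((U k).sub_mem (hlk i) (hlk i'))))
  obtain ⟨i, hi⟩ := ((Fintype.bijective_iff_injective_and_card m).2 ⟨hminj, by simp⟩).2 ⟨j, hj⟩
  refine ⟨l i, hlS i, hlk i, ?_⟩
  have := hm i
  rwa [hi] at this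

theorem IsNewLagrangian.exists_ne_zero {U : Fin 5 → Submodule (ZMod 2) V}
    {S : Submodule (ZMod 2) V} (hω : IsSymplecticSix ω) (hU : ∀ k, IsLagrangian ω (U k))
    (hd : ∀ j k, j ≠ k → Disjoint (U j) (U k)) (hS : IsNewLagrangian ω U S) (j : Fin 5) :
    ∃ v ∈ S, v ∈ U j ∧ v ≠ 0 := by
  obtain ⟨k, a, b, c, haS, hak, hbS, hbk, ha, hb, hab, hcS, hck, hl⟩ := hS.exists_line hω hU hd
  by_cases hj : j = k
  · exact ⟨a, haS, hj ▸ hak, ha⟩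
  · obtain ⟨l, hlS, hlk, hlj⟩ := hl j hj
    refine ⟨c + l, S.add_mem hcS hlS, hlj, fun h => hck ?_⟩
    rw [binary_eq_of_add_eq_zero h]
    exact hlk

/-- The condition `p + q ≠ r` gives independence. If one of the three indices is `k`, the plane in
`U k` offers two nonzero vectors, one of which avoids the bad value. Otherwise all three vectors lie
in the coset of `c`, so that `p + q` is in `U k` and `r` is not. -/
theorem IsNewLagrangian.exists_generators {U : Fin 5 → Submodule (ZMod 2) V}
    {S : Submodule (ZMod 2) V} (hω : IsSymplecticSix ω) (hU : ∀ k, IsLagrangian ω (U k))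
    (hd : ∀ j k, j ≠ k → Disjoint (U j) (U k)) (hS : IsNewLagrangian ω U S)
    {j₀ j₁ j₂ : Fin 5} (h01 : j₀ ≠ j₁) (h02 : j₀ ≠ j₂) (h12 : j₁ ≠ j₂) :
    ∃ p ∈ S, ∃ q ∈ S, ∃ r ∈ S, p ∈ U j₀ ∧ q ∈ U j₁ ∧ r ∈ U j₂ ∧ p ≠ 0 ∧ q ≠ 0 ∧ r ≠ 0 ∧
      p + q ≠ r := by
  obtain ⟨k, a, b, c, haS, hak, hbS, hbk, ha, hb, hab, hcS, hck, hl⟩ := hS.exists_line hω hU hd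
  have hne : ∀ l ∈ U k, c + l ≠ 0 := fun l hlk h => hck (by
    rw [binary_eq_of_add_eq_zero h]; exact hlk)
  have hav : ∀ v : V, ∃ p ∈ S, p ∈ U k ∧ p ≠ 0 ∧ p ≠ v := fun v => by
    by_cases h : a = v
    · exact ⟨b, hbS, hbk, hb, fun h' => hab (h.trans h'.symm)⟩
    · exact ⟨a, haS, hak, ha, h⟩
  by_cases h0 : j₀ = k
  · subst h0
    obtain ⟨l₁, h1S, h1k, h1⟩ := hl j₁ h01.symm
    obtain ⟨l₂, h2S, h2k, h2⟩ := hl j₂ h02.symm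
    obtain ⟨p, hpS, hpk, hp0, hp⟩ := hav ((c + l₂) - (c + l₁))
    exact ⟨p, hpS, _, S.add_mem hcS h1S, _, S.add_mem hcS h2S, hpk, h1, h2, hp0, hne _ h1k,
      hne _ h2k, fun h => hp (eq_sub_of_add_eq h)⟩
  by_cases h1 : j₁ = k
  · subst h1
    obtain ⟨l₁, h1S, h1k, h1⟩ := hl j₀ h01
    obtain ⟨l₂, h2S, h2k, h2⟩ := hl j₂ h12.symm
    obtain ⟨p, hpS, hpk, hp0, hp⟩ := hav ((c + l₂) - (c + l₁))
    exact ⟨_, S.add_mem hcS h1S, p, hpS, _, S.add_mem hcS h2S, h1, hpk, h2, hne _ h1k, hp0,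
      hne _ h2k, fun h => hp (eq_sub_of_add_eq' h)⟩
  by_cases h2 : j₂ = k
  · subst h2
    obtain ⟨l₁, h1S, h1k, h1⟩ := hl j₀ h02
    obtain ⟨l₂, h2S, h2k, h2⟩ := hl j₁ h12
    obtain ⟨p, hpS, hpk, hp0, hp⟩ := hav ((c + l₁) + (c + l₂))
    exact ⟨_, S.add_mem hcS h1S, _, S.add_mem hcS h2S, p, hpS, h1, h2, hpk, hne _ h1k, hne _ h2k,
      hp0, hp.symm⟩
  obtain ⟨l₀, h0S, h0k, h0'⟩ := hl j₀ h0
  obtain ⟨l₁, h1S, h1k, h1'⟩ := hl j₁ h1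
  obtain ⟨l₂, h2S, h2k, h2'⟩ := hl j₂ h2
  refine ⟨_, S.add_mem hcS h0S, _, S.add_mem hcS h1S, _, S.add_mem hcS h2S, h0', h1', h2',
    hne _ h0k, hne _ h1k, hne _ h2k, fun h => hck ?_⟩
  have hc : c = l₀ + l₁ - l₂ := by
    have : c + c = 0 := binary_add_self c
    have h' : (c + c) + (l₀ + l₁) = c + l₂ := by rw [← h]; abel
    rw [this, zero_add] at h'
    rw [h']; abel
  rw [hc]
  exact (U k).sub_mem ((U k).add_mem h0k h1k) h2k

section Span

variable {U₀ U₁ : Submodule (ZMod 2) V} {e f : BinTriple →ₗ[ZMod 2] V}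

/-- The span of `(x, 0)`, `(0, y)`, `(z, z)` in coordinates. -/
def frameSpan (e f : BinTriple →ₗ[ZMod 2] V) (x y z : BinTriple) : BinTriple →ₗ[ZMod 2] V :=
  tripleComb (e x) (f y) (e z + f z)

theorem frameSpan_apply (x y z t : BinTriple) :
    frameSpan e f x y z t = e (t.1 • x + t.2.2 • z) + f (t.2.1 • y + t.2.2 • z) := by
  simp only [frameSpan, tripleComb_apply, map_add, map_smul]
  module

theorem tripleComb_injective {a b c : V} (ha : a ≠ 0) (hb : b ≠ 0) (hc : c ≠ 0) (hab : a ≠ b)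
    (hac : a ≠ c) (hbc : b ≠ c) (habc : a + b ≠ c) : Function.Injective (tripleComb a b c) := by
  refine (injective_iff_map_eq_zero _).2 fun t ht => ?_
  obtain ⟨t1, t2, t3⟩ := t
  rw [tripleComb_apply] at ht
  rcases zmod_two_cases t1 with rfl | rfl <;> rcases zmod_two_cases t2 with rfl | rfl <;>
    rcases zmod_two_cases t3 with rfl | rfl <;>
    simp only [zero_smul, one_smul, zero_add, add_zero] at ht
  · rfl
  · exact absurd ht hc
  · exact absurd ht hb
  · exact absurd (binary_eq_of_add_eq_zero ht) hbc
  · exact absurd ht ha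
  · exact absurd (binary_eq_of_add_eq_zero ht) hac
  · exact absurd (binary_eq_of_add_eq_zero ht) hab
  · exact absurd (binary_eq_of_add_eq_zero ht) habc

theorem IsLagrangianFrame.eq_iff (h : IsLagrangianFrame ω U₀ U₁ e f) (h₀₁ : Disjoint U₀ U₁)
    {x y x' y' : BinTriple} : e x + f y = e x' + f y' ↔ x = x' ∧ y = y' := by
  refine ⟨fun hh => ?_, by rintro ⟨rfl, rfl⟩; rfl⟩
  have hz : e (x - x') + f (y - y') = 0 := by
    rw [map_sub, map_sub, sub_add_sub_comm, hh, sub_self]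
  have hy : y - y' = 0 := by rw [← h.mem_left_iff h₀₁ (x - x'), hz]; exact U₀.zero_mem
  rw [hy, map_zero, add_zero] at hz
  exact ⟨sub_eq_zero.1 ((injective_iff_map_eq_zero e).1 h.left_injective _ hz), sub_eq_zero.1 hy⟩

theorem IsLagrangianFrame.frameSpan_injective (h : IsLagrangianFrame ω U₀ U₁ e f)
    (h₀₁ : Disjoint U₀ U₁) {x y z : BinTriple} (hx : x ≠ 0) (hy : y ≠ 0) (hz : z ≠ 0)
    (hxyz : ¬ (x = z ∧ y = z)) : Function.Injective (frameSpan e f x y z) := by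
  have key := fun x y x' y' => h.eq_iff h₀₁ (x := x) (y := y) (x' := x') (y' := y')
  apply tripleComb_injective
  · simpa [hx] using key x 0 0 0
  · simpa [hy] using key 0 y 0 0
  · simpa [hz] using key z z 0 0
  · simpa [hx] using key x 0 0 y
  · simpa [hz.symm] using key x 0 z z
  · simpa [hz.symm] using key 0 y z z
  · simpa [hxyz] using key x y z z

end Span

/-- The intersection pattern of five disjoint Lagrangians, expressed in coordinates. -/
structure IsFiveFrame (ω : LinearMap.BilinForm (ZMod 2) V) (U : Fin 5 → Submodule (ZMod 2) V)
    (e f : BinTriple →ₗ[ZMod 2] V) (B C : BinSym) : Prop where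
  frame : IsLagrangianFrame ω (U 0) (U 1) e f
  graph_id : ∀ y, e (BinSym.id.apply y) + f y ∈ U 2
  graph_left : ∀ y, e (B.apply y) + f y ∈ U 3
  graph_right : ∀ y, e (C.apply y) + f y ∈ U 4

theorem IsFiveFrame.exists_mem_iff {U : Fin 5 → Submodule (ZMod 2) V}
    {e f : BinTriple →ₗ[ZMod 2] V} {B C : BinSym} (h : IsFiveFrame ω U e f B C)
    (hd : ∀ j k, j ≠ k → Disjoint (U j) (U k)) (x y : BinTriple) :
    (∃ k, e x + f y ∈ U k) ↔ InFiveGraphs B C x y := by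
  have h0 := h.frame.mem_left_iff (hd 0 1 (by decide)) x y
  have h1 := h.frame.mem_graph_iff (hd 0 1 (by decide)) (B := 0)
    (fun y => by simpa [BinSym.zero_apply] using h.frame.right_mem y) x y
  have h2 := h.frame.mem_graph_iff (hd 0 2 (by decide)) h.graph_id x y
  have h3 := h.frame.mem_graph_iff (hd 0 3 (by decide)) h.graph_left x y
  have h4 := h.frame.mem_graph_iff (hd 0 4 (by decide)) h.graph_right x y
  rw [BinSym.zero_apply] at h1
  rw [BinSym.id_apply] at h2
  unfold InFiveGraphs
  rw [← h0, ← h1, ← h2, ← h3, ← h4]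
  refine ⟨?_, ?_⟩
  · rintro ⟨k, hk⟩
    fin_cases k
    exacts [Or.inl hk, Or.inr (Or.inl hk), Or.inr (Or.inr (Or.inl hk)),
      Or.inr (Or.inr (Or.inr (Or.inl hk))), Or.inr (Or.inr (Or.inr (Or.inr hk)))]
  · rintro (hk | hk | hk | hk | hk)
    exacts [⟨0, hk⟩, ⟨1, hk⟩, ⟨2, hk⟩, ⟨3, hk⟩, ⟨4, hk⟩]

/-- The first three Lagrangians fix the coordinates, the next two become `B` and `C`, and the sixth
serves only as the witness of `HasFurtherGraph`. -/
theorem exists_fiveFrame {U : Fin 6 → Submodule (ZMod 2) V} (hω : IsSymplecticSix ω)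
    (hU : ∀ k, IsLagrangian ω (U k)) (hd : ∀ j k, j ≠ k → Disjoint (U j) (U k)) :
    ∃ e f B C, IsFiveFrame ω (fun k : Fin 5 => U k.castSucc) e f B C ∧ B.IsSpreadElement ∧
      C.IsSpreadElement ∧ B.Transversal C ∧ HasFurtherGraph B C := by
  have h01 := hd 0 1 (by decide)
  obtain ⟨e, f, hef, h2⟩ := exists_frame hω (hU 0) (hU 1) (hU 2) h01
    (hd 0 2 (by decide)) (hd 1 2 (by decide))
  obtain ⟨B, hB⟩ := hef.exists_graph hω (hU 0) (hU 1) h01 (hU 3) (hd 0 3 (by decide))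
  obtain ⟨C, hC⟩ := hef.exists_graph hω (hU 0) (hU 1) h01 (hU 4) (hd 0 4 (by decide))
  obtain ⟨D, hD⟩ := hef.exists_graph hω (hU 0) (hU 1) h01 (hU 5) (hd 0 5 (by decide))
  have hz : ∀ y, e ((0 : BinSym).apply y) + f y ∈ U 1 := fun y => by
    simpa [BinSym.zero_apply] using hef.right_mem y
  have hi : ∀ y, e (BinSym.id.apply y) + f y ∈ U 2 := fun y => by
    simpa [BinSym.id_apply] using h2 y
  exact ⟨e, f, B, C, ⟨hef, hi, hB, hC⟩,
    ⟨hef.transversal h01 (hd 3 1 (by decide)) hB hz, hef.transversal h01 (hd 3 2 (by decide)) hB hi⟩,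
    ⟨hef.transversal h01 (hd 4 1 (by decide)) hC hz, hef.transversal h01 (hd 4 2 (by decide)) hC hi⟩,
    hef.transversal h01 (hd 3 4 (by decide)) hB hC, D,
    ⟨hef.transversal h01 (hd 5 1 (by decide)) hD hz, hef.transversal h01 (hd 5 2 (by decide)) hD hi⟩,
    hef.transversal h01 (hd 3 5 (by decide)) hB hD, hef.transversal h01 (hd 4 5 (by decide)) hC hD⟩

theorem IsFiveFrame.isNewLagrangian {U : Fin 5 → Submodule (ZMod 2) V}
    {e f : BinTriple →ₗ[ZMod 2] V} {B C : BinSym} (h : IsFiveFrame ω U e f B C)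
    (hω : IsSymplecticSix ω) (hU : ∀ k, IsLagrangian ω (U k))
    (hd : ∀ j k, j ≠ k → Disjoint (U j) (U k)) {x y z : BinTriple}
    (hs : SpansNewLagrangian B C x y z) :
    IsNewLagrangian ω U (LinearMap.range (frameSpan e f x y z)) := by
  obtain ⟨hx, hy, hz, hxy, hxz, hyz, hne, c1, c2, c3, c4⟩ := hs
  have h01 := hd 0 1 (by decide)
  have hinj := h.frame.frameSpan_injective h01 hx hy hz hne
  refine ⟨⟨?_, ?_⟩, ?_, ?_⟩
  · rintro _ ⟨s, rfl⟩ _ ⟨t, rfl⟩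
    rw [frameSpan_apply, frameSpan_apply, h.frame.form_eq hω (hU 0) (hU 1)]
    simp only [tripleDot_add_left, tripleDot_add_right, tripleDot_smul_left, tripleDot_smul_right,
      hxy, hxz, tripleDot_comm z y, hyz]
    have h2 : (2 : ZMod 2) = 0 := rfl
    -- The only surviving term, the pairing of `(z, z)` with itself, occurs twice.
    linear_combination s.2.2 * t.2.2 * tripleDot z z * h2
  · rw [LinearMap.finrank_range_of_inj hinj, finrank_binTriple]
  · rintro _ ⟨⟨t1, t2, t3⟩, rfl⟩
    rw [frameSpan_apply, h.exists_mem_iff hd]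
    rcases zmod_two_cases t1 with rfl | rfl <;> rcases zmod_two_cases t2 with rfl | rfl <;>
      rcases zmod_two_cases t3 with rfl | rfl <;>
      simp only [zero_smul, one_smul, zero_add, add_zero]
    · exact Or.inl rfl
    · exact Or.inr (Or.inr (Or.inl rfl))
    · exact Or.inr (Or.inl rfl)
    · exact c3
    · exact Or.inl rfl
    · exact c2
    · exact c1
    · exact c4
  -- The span contains nonzero vectors of both `U 0` and `U 1`, which no single `U k` does.
  · intro k hk
    have hxm : e x ∈ U k := by
      rw [← hk]; exact ⟨(1, 0, 0), by simp [frameSpan_apply]⟩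
    have hym : f y ∈ U k := by
      rw [← hk]; exact ⟨(0, 1, 0), by simp [frameSpan_apply]⟩
    by_cases hk0 : 0 = k
    · subst hk0
      exact hy ((injective_iff_map_eq_zero f).1 h.frame.right_injective _
        (Submodule.disjoint_def.1 h01 _ hym (h.frame.right_mem y)))
    · exact hx ((injective_iff_map_eq_zero e).1 h.frame.left_injective _
        (Submodule.disjoint_def.1 (hd 0 k hk0) _ (h.frame.left_mem x) hxm))

/-- Converse of `IsFiveFrame.isNewLagrangian`: independent vectors of `S` in `U 0`, `U 1`, `U 2`
have the coordinates `(x, 0)`, `(0, y)`, `(z, z)`, and they span `S` by dimension. -/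
theorem IsFiveFrame.exists_span {U : Fin 5 → Submodule (ZMod 2) V}
    {e f : BinTriple →ₗ[ZMod 2] V} {B C : BinSym} (h : IsFiveFrame ω U e f B C)
    (hω : IsSymplecticSix ω) (hU : ∀ k, IsLagrangian ω (U k))
    (hd : ∀ j k, j ≠ k → Disjoint (U j) (U k)) {S : Submodule (ZMod 2) V}
    (hS : IsNewLagrangian ω U S) :
    ∃ x y z, SpansNewLagrangian B C x y z ∧ S = LinearMap.range (frameSpan e f x y z) := by
  have := hω.finite
  have h01 := hd 0 1 (by decide)
  obtain ⟨p, hpS, q, hqS, r, hrS, hp, hq, hr, hp0, hq0, hr0, hpqr⟩ :=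
    hS.exists_generators hω hU hd (j₀ := 0) (j₁ := 1) (j₂ := 2) (by decide) (by decide) (by decide)
  obtain ⟨x, rfl⟩ := (hU 0).exists_of_injective hω h.frame.left_injective h.frame.left_mem hp
  obtain ⟨y, rfl⟩ := (hU 1).exists_of_injective hω h.frame.right_injective h.frame.right_mem hq
  obtain ⟨z', z, rfl⟩ := h.frame.exists_coordinates hω (hU 0) (hU 1) h01 r
  have hz := (h.frame.mem_graph_iff (hd 0 2 (by decide)) h.graph_id z' z).1 hr
  rw [BinSym.id_apply] at hz
  subst hz
  have hx0 : x ≠ 0 := by rintro rfl; simp at hp0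
  have hy0 : y ≠ 0 := by rintro rfl; simp at hq0
  have hz0 : z' ≠ 0 := by rintro rfl; simp at hr0
  have hne : ¬ (x = z' ∧ y = z') := by rintro ⟨rfl, rfl⟩; exact hpqr rfl
  have hmem : ∀ t, frameSpan e f x y z' t ∈ S := fun t =>
    S.add_mem (S.add_mem (S.smul_mem _ hpS) (S.smul_mem _ hqS)) (S.smul_mem _ hrS)
  have hiso := fun s t => hS.lagrangian.isotropic _ (hmem s) _ (hmem t)
  have hcov := fun t => hS.covered _ (hmem t)
  simp only [frameSpan_apply, h.exists_mem_iff hd] at hcov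
  simp only [frameSpan_apply, h.frame.form_eq hω (hU 0) (hU 1)] at hiso
  refine ⟨x, y, z', ⟨hx0, hy0, hz0, ?_, ?_, ?_, hne, ?_, ?_, ?_, ?_⟩, ?_⟩
  · simpa [tripleDot] using hiso (1, 0, 0) (0, 1, 0)
  · simpa [tripleDot] using hiso (1, 0, 0) (0, 0, 1)
  · simpa [tripleDot, mul_comm] using hiso (0, 1, 0) (0, 0, 1)
  · simpa using hcov (1, 1, 0)
  · simpa using hcov (1, 0, 1)
  · simpa using hcov (0, 1, 1)
  · simpa using hcov (1, 1, 1)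
  · refine (Submodule.eq_of_le_of_finrank_eq ?_ ?_).symm
    · rintro _ ⟨t, rfl⟩; exact hmem t
    · rw [LinearMap.finrank_range_of_inj (h.frame.frameSpan_injective h01 hx0 hy0 hz0 hne),
        finrank_binTriple, hS.lagrangian.finrank_eq]

/-- If five disjoint Lagrangians extend to six, they cover exactly one new Lagrangian. -/
theorem existsUnique_isNewLagrangian {U : Fin 6 → Submodule (ZMod 2) V} (hω : IsSymplecticSix ω)
    (hU : ∀ k, IsLagrangian ω (U k)) (hd : ∀ j k, j ≠ k → Disjoint (U j) (U k)) :
    ∃! S, IsNewLagrangian ω (fun k : Fin 5 => U k.castSucc) S := by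
  have := hω.finite
  obtain ⟨e, f, B, C, hF, hB, hC, hBC, hD⟩ := exists_fiveFrame hω hU hd
  have hU' := fun k : Fin 5 => hU k.castSucc
  have hd' : ∀ j k : Fin 5, j ≠ k → Disjoint (U j.castSucc) (U k.castSucc) := fun j k hjk =>
    hd _ _ fun h => hjk (Fin.castSucc_injective _ h)
  obtain ⟨x, y, z, hxyz⟩ := exists_spansNewLagrangian B hB C hC hBC hD
  have hS := hF.isNewLagrangian hω hU' hd' hxyz
  refine ⟨_, hS, fun T hT => ?_⟩
  obtain ⟨x', y', z', hs', rfl⟩ := hF.exists_span hω hU' hd' hT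
  obtain ⟨hx, hy, hz⟩ := spansNewLagrangian_unique B hB C hC hBC hD x y z hxyz x' y' z' hs'
  have hmem : ∀ u v, InTripleSpan x y z u v →
      e u + f v ∈ LinearMap.range (frameSpan e f x y z) := by
    rintro _ _ ⟨a, b, c, rfl, rfl⟩
    exact ⟨(a, b, c), frameSpan_apply x y z _⟩
  refine Submodule.eq_of_le_of_finrank_eq ?_
    (by rw [hT.lagrangian.finrank_eq, hS.lagrangian.finrank_eq])
  rintro _ ⟨t, rfl⟩
  have h1 := hmem _ _ hx
  have h2 := hmem _ _ hy
  rw [map_zero, add_zero] at h1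
  rw [map_zero, zero_add] at h2
  exact Submodule.add_mem _ (Submodule.add_mem _ (Submodule.smul_mem _ _ h1)
    (Submodule.smul_mem _ _ h2)) (Submodule.smul_mem _ _ (hmem _ _ hz))

end NewLagrangian

/-! ### Pauli operators indexed by the symplectic space -/

/-- Exponents of `X` and `Z` for each of three qubits. -/
abbrev PauliIndex : Type := (ZMod 2 × ZMod 2) × (ZMod 2 × ZMod 2) × (ZMod 2 × ZMod 2)

/-- The symplectic form of one qubit. -/
def qubitForm (a b : ZMod 2 × ZMod 2) : ZMod 2 := a.1 * b.2 + a.2 * b.1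

/-- The symplectic form of three qubits. -/
def pauliForm : LinearMap.BilinForm (ZMod 2) PauliIndex :=
  LinearMap.mk₂ (ZMod 2)
    (fun u v => qubitForm u.1 v.1 + qubitForm u.2.1 v.2.1 + qubitForm u.2.2 v.2.2)
    (fun u u' v => by simp only [qubitForm, Prod.fst_add, Prod.snd_add]; ring)
    (fun c u v => by simp only [qubitForm, Prod.smul_fst, Prod.smul_snd, smul_eq_mul]; ring)
    (fun u v v' => by simp only [qubitForm, Prod.fst_add, Prod.snd_add]; ring)
    (fun c u v => by simp only [qubitForm, Prod.smul_fst, Prod.smul_snd, smul_eq_mul]; ring)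

theorem pauliForm_apply (u v : PauliIndex) : pauliForm u v =
    qubitForm u.1 v.1 + qubitForm u.2.1 v.2.1 + qubitForm u.2.2 v.2.2 := rfl

theorem exists_pauliForm_eq_one {v : PauliIndex} (hv : v ≠ 0) : ∃ w, pauliForm v w = 1 := by
  have h : ∀ v : PauliIndex, v ≠ 0 → ∃ w : PauliIndex,
      qubitForm v.1 w.1 + qubitForm v.2.1 w.2.1 + qubitForm v.2.2 w.2.2 = 1 := by
    decide +kernel
  exact h v hv

theorem isSymplecticSix_pauliForm : IsSymplecticSix pauliForm := by
  have halt : pauliForm.IsAlt := fun v => by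
    simp only [pauliForm_apply, qubitForm]
    have h2 : (2 : ZMod 2) = 0 := rfl
    linear_combination (v.1.1 * v.1.2 + v.2.1.1 * v.2.1.2 + v.2.2.1 * v.2.2.2) * h2
  have hsep : ∀ v, (∀ w, pauliForm v w = 0) → v = 0 := fun v hv => by
    by_contra h
    obtain ⟨w, hw⟩ := exists_pauliForm_eq_one h
    rw [hv w] at hw
    exact zero_ne_one hw
  refine ⟨by simp, ⟨hsep, fun v hv => hsep v fun w => ?_⟩, halt⟩
  rw [← halt.neg_eq, hv, neg_zero]

/-- The sign character of `ZMod 2`. -/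
def binSign (a : ZMod 2) : ℂ := if a = 0 then 1 else -1

theorem binSign_add (a b : ZMod 2) : binSign (a + b) = binSign a * binSign b := by
  rcases zmod_two_cases a with rfl | rfl <;> rcases zmod_two_cases b with rfl | rfl <;>
    simp [binSign, show (1 + 1 : ZMod 2) = 0 from rfl]

/-- The position of the Pauli matrix with given exponents of `X` and `Z`. -/
def qubitCode (a : ZMod 2 × ZMod 2) : Fin 4 :=
  if a.1 = 0 then (if a.2 = 0 then 0 else 3) else (if a.2 = 0 then 1 else 2)

theorem qubitCode_bijective : Function.Bijective qubitCode := by decide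

/-- The single-qubit Pauli matrix with given exponents of `X` and `Z`. -/
noncomputable def qubitPauli (a : ZMod 2 × ZMod 2) : Matrix (Fin 2) (Fin 2) ℂ := pauli (qubitCode a)

theorem qubitPauli_mul_comm (a b : ZMod 2 × ZMod 2) :
    qubitPauli a * qubitPauli b = binSign (qubitForm a b) • (qubitPauli b * qubitPauli a) := by
  obtain ⟨a1, a2⟩ := a
  obtain ⟨b1, b2⟩ := b
  rcases zmod_two_cases a1 with rfl | rfl <;> rcases zmod_two_cases a2 with rfl | rfl <;>
    rcases zmod_two_cases b1 with rfl | rfl <;> rcases zmod_two_cases b2 with rfl | rfl <;>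
    simp [qubitPauli, qubitCode, qubitForm, binSign, pauli, show (1 + 1 : ZMod 2) = 0 from rfl]

theorem qubitPauli_mul_self (a : ZMod 2 × ZMod 2) : qubitPauli a * qubitPauli a = 1 := by
  obtain ⟨a1, a2⟩ := a
  rcases zmod_two_cases a1 with rfl | rfl <;> rcases zmod_two_cases a2 with rfl | rfl <;>
    simp [qubitPauli, qubitCode, pauli, Matrix.one_fin_two]

theorem qubitPauli_isHermitian (a : ZMod 2 × ZMod 2) : (qubitPauli a).IsHermitian := by
  obtain ⟨a1, a2⟩ := a
  rcases zmod_two_cases a1 with rfl | rfl <;> rcases zmod_two_cases a2 with rfl | rfl <;>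
    ext i j <;> fin_cases i <;> fin_cases j <;> simp [qubitPauli, qubitCode, pauli]

theorem qubitPauli_zero : qubitPauli 0 = 1 := by
  simp [qubitPauli, qubitCode, pauli, Matrix.one_fin_two]

/-- Completeness relation: the sum of `P ⊗ P` over the Pauli matrices is twice the swap. -/
theorem sum_qubitPauli (i j k l : Fin 2) :
    ∑ a, qubitPauli a i j * qubitPauli a k l = if i = l ∧ j = k then 2 else 0 := by
  have h : ∑ a, qubitPauli a i j * qubitPauli a k l = ∑ c, pauli c i j * pauli c k l :=
    (Equiv.ofBijective _ qubitCode_bijective).sum_comp (fun c => pauli c i j * pauli c k l)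
  rw [h, Fin.sum_univ_four]
  fin_cases i <;> fin_cases j <;> fin_cases k <;> fin_cases l <;> simp [pauli] <;> norm_num

/-- The three-qubit Pauli operator of an index. -/
noncomputable def pauliOp (v : PauliIndex) : Matrix ThreeQubits ThreeQubits ℂ :=
  qubitPauli v.1 ⊗ₖ (qubitPauli v.2.1 ⊗ₖ qubitPauli v.2.2)

theorem range_pauliOp : Set.range pauliOp = threeQubitPaulis := by
  ext U
  constructor
  · rintro ⟨v, rfl⟩
    exact ⟨_, _, _, rfl⟩
  · rintro ⟨a, b, c, rfl⟩
    obtain ⟨a, rfl⟩ := qubitCode_bijective.2 a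
    obtain ⟨b, rfl⟩ := qubitCode_bijective.2 b
    obtain ⟨c, rfl⟩ := qubitCode_bijective.2 c
    exact ⟨(a, b, c), rfl⟩

theorem pauliOp_zero : pauliOp 0 = 1 := by
  simp only [pauliOp, Prod.fst_zero, Prod.snd_zero, qubitPauli_zero, Matrix.one_kronecker_one]

theorem pauliOp_mul_self (v : PauliIndex) : pauliOp v * pauliOp v = 1 := by
  simp only [pauliOp, ← Matrix.mul_kronecker_mul, qubitPauli_mul_self, Matrix.one_kronecker_one]

theorem pauliOp_ne_zero (v : PauliIndex) : pauliOp v ≠ 0 := fun h => by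
  have := pauliOp_mul_self v
  rw [h, zero_mul] at this
  exact zero_ne_one this

theorem pauliOp_isHermitian (v : PauliIndex) : (pauliOp v).IsHermitian := by
  unfold Matrix.IsHermitian
  simp only [pauliOp, Matrix.conjTranspose_kronecker, (qubitPauli_isHermitian _).eq]

theorem pauliOp_mul_comm (u v : PauliIndex) :
    pauliOp u * pauliOp v = binSign (pauliForm u v) • (pauliOp v * pauliOp u) := by
  simp only [pauliOp, ← Matrix.mul_kronecker_mul, pauliForm_apply, binSign_add]
  rw [qubitPauli_mul_comm u.1, qubitPauli_mul_comm u.2.1, qubitPauli_mul_comm u.2.2]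
  simp only [Matrix.smul_kronecker, Matrix.kronecker_smul, smul_smul]
  congr 1
  ring

/-- Two Pauli operators commute or anticommute; doing both would make their product zero, although
each squares to the identity. -/
theorem commute_pauliOp_iff (u v : PauliIndex) :
    Commute (pauliOp u) (pauliOp v) ↔ pauliForm u v = 0 := by
  have h := pauliOp_mul_comm u v
  refine ⟨fun hc => ?_, fun h0 => ?_⟩
  · by_contra h0
    rw [show binSign (pauliForm u v) = -1 from if_neg h0, ← hc.eq, neg_one_smul] at h
    replace h : pauliOp u * pauliOp v = 0 := by
      ext i j
      have hij := congrFun (congrFun h i) j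
      rw [Matrix.neg_apply] at hij
      rw [Matrix.zero_apply]
      linear_combination hij / 2
    have h1 : pauliOp u * (pauliOp v * pauliOp v) = 0 := by rw [← mul_assoc, h, zero_mul]
    rw [pauliOp_mul_self, mul_one] at h1
    exact pauliOp_ne_zero u h1
  · rw [h0, show binSign 0 = 1 from if_pos rfl, one_smul] at h
    exact h

theorem pauliOp_ne_smul_one {v : PauliIndex} (hv : v ≠ 0) (c : ℂ) : pauliOp v ≠ c • 1 := by
  intro h
  obtain ⟨w, hw⟩ := exists_pauliForm_eq_one hv
  have hc : Commute (pauliOp v) (pauliOp w) := by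
    rw [h]; exact (Commute.one_left _).smul_left c
  rw [commute_pauliOp_iff, hw] at hc
  exact one_ne_zero hc

theorem pauliOp_injective : Function.Injective pauliOp := by
  intro u v h
  by_contra hne
  obtain ⟨w, hw⟩ := exists_pauliForm_eq_one (sub_ne_zero.2 hne)
  have h1 := commute_pauliOp_iff u w
  rw [h, commute_pauliOp_iff] at h1
  rw [map_sub, LinearMap.sub_apply] at hw
  rcases zmod_two_cases (pauliForm u w) with hu | hu <;>
    rcases zmod_two_cases (pauliForm v w) with hv | hv <;> simp_all

theorem pauliOp_eq_one_iff (v : PauliIndex) : pauliOp v = 1 ↔ v = 0 := by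
  rw [← pauliOp_zero, pauliOp_injective.eq_iff]

/-- The Pauli operators form a unitary basis up to normalization. -/
theorem sum_pauliOp (i j k l : ThreeQubits) :
    ∑ v, pauliOp v i j * pauliOp v k l = if i = l ∧ j = k then 8 else 0 := by
  have h : ∑ v, pauliOp v i j * pauliOp v k l =
      (∑ a, qubitPauli a i.1 j.1 * qubitPauli a k.1 l.1) *
      ((∑ a, qubitPauli a i.2.1 j.2.1 * qubitPauli a k.2.1 l.2.1) *
      (∑ a, qubitPauli a i.2.2 j.2.2 * qubitPauli a k.2.2 l.2.2)) := by
    rw [Finset.sum_mul_sum, Finset.sum_mul_sum, Fintype.sum_prod_type]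
    refine Finset.sum_congr rfl fun a _ => ?_
    rw [Fintype.sum_prod_type, Finset.sum_comm]
    simp only [Finset.mul_sum]
    rw [Finset.sum_comm]
    refine Finset.sum_congr rfl fun b _ => Finset.sum_congr rfl fun c _ => ?_
    simp only [pauliOp, Matrix.kroneckerMap_apply]
    ring
  rw [h, sum_qubitPauli, sum_qubitPauli, sum_qubitPauli]
  obtain ⟨i1, i2, i3⟩ := i
  obtain ⟨j1, j2, j3⟩ := j
  obtain ⟨k1, k2, k3⟩ := k
  obtain ⟨l1, l2, l3⟩ := l
  simp only [Prod.mk.injEq]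
  split_ifs <;> first | (exfalso; tauto) | norm_num

/-! ### Maximal commuting classes and Lagrangians -/

/-- The operators of the nonzero elements of a subspace. -/
def pauliClass (W : Submodule (ZMod 2) PauliIndex) : Set (Matrix ThreeQubits ThreeQubits ℂ) :=
  pauliOp '' {v | v ∈ W ∧ v ≠ 0}

theorem pauliOp_mem_pauliClass {W : Submodule (ZMod 2) PauliIndex} {v : PauliIndex} :
    pauliOp v ∈ pauliClass W ↔ v ∈ W ∧ v ≠ 0 :=
  pauliOp_injective.mem_set_image

theorem pauliClass_subset_iUnion {κ : Type*} {U : κ → Submodule (ZMod 2) PauliIndex} [Nonempty κ]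
    {W : Submodule (ZMod 2) PauliIndex} :
    pauliClass W ⊆ ⋃ k, pauliClass (U k) ↔ ∀ v ∈ W, ∃ k, v ∈ U k := by
  constructor
  · intro h v hv
    by_cases h0 : v = 0
    · exact ⟨Classical.arbitrary κ, h0 ▸ (U _).zero_mem⟩
    · obtain ⟨k, hk⟩ := Set.mem_iUnion.1 (h (pauliOp_mem_pauliClass.2 ⟨hv, h0⟩))
      exact ⟨k, (pauliOp_mem_pauliClass.1 hk).1⟩
  · rintro h _ ⟨v, ⟨hv, h0⟩, rfl⟩
    obtain ⟨k, hk⟩ := h v hv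
    exact Set.mem_iUnion.2 ⟨k, pauliOp_mem_pauliClass.2 ⟨hk, h0⟩⟩

theorem pauliClass_injective : Function.Injective pauliClass := by
  intro U W h
  ext v
  by_cases h0 : v = 0
  · simp [h0]
  · have := Set.ext_iff.1 h (pauliOp v)
    simpa [pauliOp_mem_pauliClass, h0] using this

theorem disjoint_pauliClass_iff {U W : Submodule (ZMod 2) PauliIndex} :
    Disjoint (pauliClass U) (pauliClass W) ↔ Disjoint U W := by
  rw [Set.disjoint_left, Submodule.disjoint_def]
  constructor
  · intro h v hU hW
    by_contra h0
    exact h (pauliOp_mem_pauliClass.2 ⟨hU, h0⟩) (pauliOp_mem_pauliClass.2 ⟨hW, h0⟩)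
  · rintro h _ ⟨v, ⟨hU, h0⟩, rfl⟩ hW
    exact h0 (h v hU (pauliOp_mem_pauliClass.1 hW).1)

theorem ncard_nonzero_add_one (W : Submodule (ZMod 2) PauliIndex) :
    {v | v ∈ W ∧ v ≠ 0}.ncard + 1 = 2 ^ Module.finrank (ZMod 2) W := by
  have h1 : Nat.card W = 2 ^ Module.finrank (ZMod 2) W := by
    rw [Module.natCard_eq_pow_finrank (K := ZMod 2), Nat.card_zmod]
  have h2 : (W : Set PauliIndex) = insert 0 {v | v ∈ W ∧ v ≠ 0} := by
    ext v
    by_cases h : v = 0 <;> simp [h]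
  rw [← h1, ← Set.ncard_insert_of_notMem (a := 0) (by simp), ← h2]
  rfl

theorem IsLagrangian.isMaximalCommutingClass {W : Submodule (ZMod 2) PauliIndex}
    (hW : IsLagrangian pauliForm W) : IsMaximalCommutingClass threeQubitPaulis (pauliClass W) := by
  refine ⟨?_, ?_, ?_⟩
  · rintro _ ⟨v, ⟨hv, h0⟩, rfl⟩
    refine ⟨range_pauliOp ▸ Set.mem_range_self v, ?_⟩
    rwa [Set.mem_singleton_iff, pauliOp_eq_one_iff]
  · rw [pauliClass, Set.ncard_image_of_injective _ pauliOp_injective, ncard_nonzero_add_one,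
      hW.finrank_eq]
    simp
  · rintro _ ⟨u, ⟨hu, -⟩, rfl⟩ _ ⟨v, ⟨hv, -⟩, rfl⟩
    exact (commute_pauliOp_iff u v).2 (hW.isotropic u hu v hv)

/-- The indices of a commuting class span an isotropic subspace, of dimension at most three and thus
with at most seven nonzero vectors. Seven operators exhaust them. -/
theorem isMaximalCommutingClass_iff {C : Set (Matrix ThreeQubits ThreeQubits ℂ)} :
    IsMaximalCommutingClass threeQubitPaulis C ↔
      ∃ W, IsLagrangian pauliForm W ∧ C = pauliClass W := by
  refine ⟨fun hC => ?_, fun ⟨W, hW, h⟩ => h ▸ hW.isMaximalCommutingClass⟩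
  set X := pauliOp ⁻¹' C with hX
  have hCX : pauliOp '' X = C := Set.image_preimage_eq_of_subset fun U hU => by
    rw [range_pauliOp]; exact (hC.subset hU).1
  have hcard : X.ncard + 1 = 8 := by
    have := hC.ncard_add_one
    rw [← hCX, Set.ncard_image_of_injective _ pauliOp_injective] at this
    simpa using this
  have hiso : ∀ u ∈ Submodule.span (ZMod 2) X, ∀ v ∈ Submodule.span (ZMod 2) X,
      pauliForm u v = 0 := by
    intro u hu v hv
    induction hu using Submodule.span_induction with
    | mem u hu =>
      induction hv using Submodule.span_induction with
      | mem v hv => exact (commute_pauliOp_iff u v).1 (hC.commute _ hu _ hv)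
      | zero => simp
      | add x y _ _ hx hy => rw [map_add, hx, hy, add_zero]
      | smul a x _ hx => rw [map_smul, hx, smul_zero]
    | zero => simp
    | add x y _ _ hx hy => rw [map_add, LinearMap.add_apply, hx, hy, add_zero]
    | smul a x _ hx => rw [map_smul, LinearMap.smul_apply, hx, smul_zero]
  have hle := isSymplecticSix_pauliForm.finrank_le_three hiso
  have hsub : X ⊆ {v | v ∈ Submodule.span (ZMod 2) X ∧ v ≠ 0} := fun v hv =>
    ⟨Submodule.subset_span hv, fun h0 => (hC.subset hv).2 (by rw [h0, pauliOp_zero]; rfl)⟩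
  have hn := ncard_nonzero_add_one (Submodule.span (ZMod 2) X)
  have h1 := Set.ncard_le_ncard hsub (Set.toFinite _)
  have h2 : 2 ^ Module.finrank (ZMod 2) (Submodule.span (ZMod 2) X) ≤ 2 ^ 3 :=
    Nat.pow_le_pow_right (by norm_num) hle
  have h3 : 2 ^ Module.finrank (ZMod 2) (Submodule.span (ZMod 2) X) = 2 ^ 3 := by omega
  refine ⟨Submodule.span (ZMod 2) X, ⟨hiso, Nat.pow_right_injective le_rfl h3⟩, ?_⟩
  rw [pauliClass, ← Set.eq_of_subset_of_ncard_le hsub (by omega) (Set.toFinite _), hCX]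

/-! ### Common eigenbases and unbiasedness -/

/-- Commuting Hermitian matrices have a common orthonormal eigenbasis. -/
theorem exists_isCommonEigenbasis {ι : Type*} [Fintype ι] [DecidableEq ι]
    {C : Set (Matrix ι ι ℂ)} (hH : ∀ U ∈ C, U.IsHermitian)
    (hC : ∀ U ∈ C, ∀ V ∈ C, Commute U V) :
    ∃ b : OrthonormalBasis ι ℂ (EuclideanSpace ℂ ι), IsCommonEigenbasis C b := by
  classical
  let T : C → EuclideanSpace ℂ ι →ₗ[ℂ] EuclideanSpace ℂ ι := fun U => Matrix.toEuclideanLin U.1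
  have hT : ∀ U, (T U).IsSymmetric := fun U =>
    Matrix.isSymmetric_toEuclideanLin_iff.2 (hH U.1 U.2)
  have hcomm : Pairwise (Function.onFun Commute T) := fun U V _ => by
    have h := hC U.1 U.2 V.1 V.2
    simp only [Function.onFun, Commute, SemiconjBy, T]
    ext x i
    simp [Module.End.mul_apply, Matrix.mulVec_mulVec, h.eq]
  -- The joint eigenspaces decompose the space orthogonally; their orthonormal bases are glued
  -- together and reindexed by dimension.
  have hI := LinearMap.IsSymmetric.directSum_isInternal_of_pairwise_commute hT hcomm
  have hO := LinearMap.IsSymmetric.orthogonalFamily_iInf_eigenspaces hT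
  let c := hI.collectedBasis fun χ => (stdOrthonormalBasis ℂ
    (⨅ U, Module.End.eigenspace (T U) (χ U) : Submodule ℂ (EuclideanSpace ℂ ι))).toBasis
  have hc : Orthonormal ℂ c := hI.collectedBasis_orthonormal hO fun χ => by
    simp
  have : Fintype (Σ χ : C → ℂ, Fin (Module.finrank ℂ
      (⨅ U, Module.End.eigenspace (T U) (χ U) : Submodule ℂ (EuclideanSpace ℂ ι)))) :=
    FiniteDimensional.fintypeBasisIndex c
  have hcard := Module.finrank_eq_card_basis c
  rw [finrank_euclideanSpace] at hcard
  let σ := Fintype.equivOfCardEq hcard.symm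
  refine ⟨(c.toOrthonormalBasis hc).reindex σ, fun U hU i => ?_⟩
  refine ⟨(σ.symm i).1 ⟨U, hU⟩, ?_⟩
  have hm := hI.collectedBasis_mem (fun χ => (stdOrthonormalBasis ℂ
    (⨅ U, Module.End.eigenspace (T U) (χ U) : Submodule ℂ (EuclideanSpace ℂ ι))).toBasis) (σ.symm i)
  rw [Submodule.mem_iInf] at hm
  have he := Module.End.mem_eigenspace_iff.1 (hm ⟨U, hU⟩)
  have he' := congrArg (fun v : EuclideanSpace ℂ ι => (v : ι → ℂ)) he
  simpa [T, c] using he'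

section Expectation

variable {ι : Type*} [Fintype ι]

/-- The expectation of `U` in the state `a`. -/
noncomputable def expectation (U : Matrix ι ι ℂ) (a : ι → ℂ) : ℂ := star a ⬝ᵥ U.mulVec a

theorem expectation_eq_sum (U : Matrix ι ι ℂ) (a : ι → ℂ) :
    expectation U a = ∑ i, ∑ j, star (a i) * U i j * a j := by
  simp only [expectation, dotProduct, Matrix.mulVec, Pi.star_apply, Finset.mul_sum, mul_assoc]

theorem dotProduct_mulVec_of_isHermitian {U : Matrix ι ι ℂ} (hU : U.IsHermitian) (a b : ι → ℂ) :
    star (U.mulVec a) ⬝ᵥ b = star a ⬝ᵥ U.mulVec b := by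
  rw [Matrix.star_mulVec, hU.eq, Matrix.dotProduct_mulVec]

/-- Eigenvectors of one of two anticommuting operators have expectation zero for the other. -/
theorem expectation_eq_zero_of_anticommute [DecidableEq ι] {U V : Matrix ι ι ℂ}
    (hV : V.IsHermitian) (hV2 : V * V = 1) (hUV : U * V = -(V * U)) {a : ι → ℂ} {l : ℂ}
    (ha : V.mulVec a = l • a) : expectation U a = 0 := by
  by_cases ha0 : a = 0
  · simp [expectation, ha0]
  have hl : l * l = 1 := by
    have h : V.mulVec (V.mulVec a) = a := by rw [Matrix.mulVec_mulVec, hV2, Matrix.one_mulVec]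
    rw [ha, Matrix.mulVec_smul, ha, smul_smul] at h
    have h' : (l * l - 1) • a = 0 := by rw [sub_smul, h, one_smul, sub_self]
    exact sub_eq_zero.1 ((smul_eq_zero.1 h').resolve_right ha0)
  have hl0 : star l = l := by
    rcases mul_self_eq_one_iff.1 hl with rfl | rfl <;> simp
  -- `V` acts on either side of the inner product through the real eigenvalue `l`, so
  -- anticommutation equates `l * expectation U a` with its negative.
  have h1 : star a ⬝ᵥ (U * V).mulVec a = l * expectation U a := by
    rw [← Matrix.mulVec_mulVec, ha, Matrix.mulVec_smul, dotProduct_smul, smul_eq_mul, expectation]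
  have h2 : star a ⬝ᵥ (V * U).mulVec a = l * expectation U a := by
    rw [← Matrix.mulVec_mulVec, ← dotProduct_mulVec_of_isHermitian hV, ha, star_smul,
      smul_dotProduct, hl0, smul_eq_mul, expectation]
  rw [hUV, Matrix.neg_mulVec, dotProduct_neg, h2] at h1
  linear_combination (-l / 2) * h1 - expectation U a * hl

end Expectation

/-- Overlaps are determined by the expectations of the Pauli operators. -/
theorem sum_expectation_mul (a b : ThreeQubits → ℂ) :
    ∑ v, expectation (pauliOp v) a * expectation (pauliOp v) b =
      8 * ((star a ⬝ᵥ b) * (star b ⬝ᵥ a)) := by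
  calc
    _ = ∑ v, ∑ i, ∑ j, ∑ k, ∑ l, (star (a i) * a j * star (b k) * b l) *
        (pauliOp v i j * pauliOp v k l) := by
      refine Finset.sum_congr rfl fun v _ => ?_
      simp only [expectation_eq_sum, Finset.sum_mul]
      simp only [Finset.mul_sum]
      refine Finset.sum_congr rfl fun i _ => Finset.sum_congr rfl fun j _ =>
        Finset.sum_congr rfl fun k _ => Finset.sum_congr rfl fun l _ => ?_
      ring
    _ = ∑ i, ∑ j, ∑ k, ∑ l, (star (a i) * a j * star (b k) * b l) *
        ∑ v, pauliOp v i j * pauliOp v k l := by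
      simp only [Finset.mul_sum]
      rw [Finset.sum_comm]
      refine Finset.sum_congr rfl fun i _ => ?_
      rw [Finset.sum_comm]
      refine Finset.sum_congr rfl fun j _ => ?_
      rw [Finset.sum_comm]
      refine Finset.sum_congr rfl fun k _ => ?_
      rw [Finset.sum_comm]
    _ = ∑ i, ∑ j, (star (a i) * a j * star (b j) * b i) * 8 := by
      simp only [sum_pauliOp]
      refine Finset.sum_congr rfl fun i _ => Finset.sum_congr rfl fun j _ => ?_
      rw [Finset.sum_eq_single j, Finset.sum_eq_single i]
      · simp
      · intro l _ hl
        rw [if_neg (fun h => hl h.1.symm), mul_zero]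
      · simp
      · intro k _ hk
        exact Finset.sum_eq_zero fun l _ => by rw [if_neg (fun h => hk h.2.symm), mul_zero]
      · simp
    _ = _ := by
      simp only [dotProduct, Pi.star_apply]
      rw [Finset.sum_mul_sum, Finset.mul_sum]
      refine Finset.sum_congr rfl fun i _ => ?_
      rw [Finset.mul_sum]
      refine Finset.sum_congr rfl fun j _ => ?_
      ring

/-- By maximality of `W`, an operator outside the class anticommutes with some member of it. -/
theorem expectation_pauliOp_eq_zero {W : Submodule (ZMod 2) PauliIndex}
    (hW : IsLagrangian pauliForm W) {b : OrthonormalBasis ThreeQubits ℂ (EuclideanSpace ℂ ThreeQubits)}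
    (hb : IsCommonEigenbasis (pauliClass W) b) {v : PauliIndex} (hv : v ∉ W) (i : ThreeQubits) :
    expectation (pauliOp v) (b i) = 0 := by
  obtain ⟨w, hw, hvw⟩ : ∃ w ∈ W, pauliForm w v ≠ 0 := by
    by_contra! h
    exact hv (hW.mem_of_orthogonal isSymplecticSix_pauliForm h)
  have hw0 : w ≠ 0 := by rintro rfl; simp at hvw
  obtain ⟨l, hl⟩ := hb _ (pauliOp_mem_pauliClass.2 ⟨hw, hw0⟩) i
  refine expectation_eq_zero_of_anticommute (pauliOp_isHermitian w) (pauliOp_mul_self w) ?_ hl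
  rw [pauliOp_mul_comm, isSymplecticSix_pauliForm.symm, binSign, if_neg hvw, neg_one_smul]

theorem inner_eq_dotProduct {ι : Type*} [Fintype ι] (a b : EuclideanSpace ℂ ι) :
    inner ℂ a b = star (a : ι → ℂ) ⬝ᵥ (b : ι → ℂ) := by
  rw [EuclideanSpace.inner_eq_star_dotProduct, dotProduct_comm]

/-- Eigenbases of disjoint Pauli classes are unbiased. -/
theorem areUnbiased_of_disjoint {U W : Submodule (ZMod 2) PauliIndex}
    (hU : IsLagrangian pauliForm U) (hW : IsLagrangian pauliForm W) (hd : Disjoint U W)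
    {a b : OrthonormalBasis ThreeQubits ℂ (EuclideanSpace ℂ ThreeQubits)}
    (ha : IsCommonEigenbasis (pauliClass U) a) (hb : IsCommonEigenbasis (pauliClass W) b) :
    AreUnbiased a b := by
  intro i j
  have h := sum_expectation_mul (a i) (b j)
  have hone : ∀ c : OrthonormalBasis ThreeQubits ℂ (EuclideanSpace ℂ ThreeQubits), ∀ k,
      expectation (pauliOp 0) (c k) = 1 := fun c k => by
    rw [expectation, pauliOp_zero, Matrix.one_mulVec, ← inner_eq_dotProduct,
      inner_self_eq_norm_sq_to_K, c.orthonormal.1 k]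
    simp
  -- A nonzero index misses `U` or `W`, so one factor of its term vanishes. Only the identity
  -- contributes, and the squared overlap is `1 / 8`.
  rw [Finset.sum_eq_single 0, hone, hone, ← inner_eq_dotProduct, ← inner_eq_dotProduct,
    ← inner_conj_symm (b j) (a i), RCLike.mul_conj] at h
  · have h' : ((‖inner ℂ (a i) (b j)‖ ^ 2 : ℝ) : ℂ) = ((1 / 8 : ℝ) : ℂ) := by
      push_cast
      have h8 : (1 : ℂ) = 8 * (‖inner ℂ (a i) (b j)‖ : ℂ) ^ 2 := by simpa using h
      linear_combination -h8 / 8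
    rw [Complex.ofReal_inj.1 h']
    simp
  · intro v _ hv
    by_cases hvU : v ∈ U
    · have hvW : v ∉ W := fun hvW => hv (Submodule.disjoint_def.1 hd v hvU hvW)
      rw [expectation_pauliOp_eq_zero hW hb hvW, mul_zero]
    · rw [expectation_pauliOp_eq_zero hU ha hvU, zero_mul]
  · simp

/-- Unbiased eigenbases belong to disjoint Pauli classes. -/
theorem disjoint_of_areUnbiased {U W : Submodule (ZMod 2) PauliIndex}
    {a b : OrthonormalBasis ThreeQubits ℂ (EuclideanSpace ℂ ThreeQubits)}
    (ha : IsCommonEigenbasis (pauliClass U) a) (hb : IsCommonEigenbasis (pauliClass W) b)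
    (hab : AreUnbiased a b) : Disjoint U W := by
  rw [Submodule.disjoint_def]
  intro v hvU hvW
  by_contra h0
  obtain ⟨l, hl⟩ := ha _ (pauliOp_mem_pauliClass.2 ⟨hvU, h0⟩) 0
  -- A shared operator would be scalar: every `b j` overlaps `a 0`, and eigenvectors of a Hermitian
  -- matrix that are not orthogonal have the same eigenvalue.
  refine pauliOp_ne_smul_one h0 (star l) ?_
  have hj : ∀ j, (pauliOp v).mulVec (b j) = star l • (b j : ThreeQubits → ℂ) := fun j => by
    obtain ⟨m, hm⟩ := hb _ (pauliOp_mem_pauliClass.2 ⟨hvW, h0⟩) j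
    have h := dotProduct_mulVec_of_isHermitian (pauliOp_isHermitian v) (a 0) (b j)
    rw [hl, hm, star_smul, smul_dotProduct, dotProduct_smul, ← inner_eq_dotProduct,
      smul_eq_mul, smul_eq_mul] at h
    have hne : inner ℂ (a 0) (b j) ≠ 0 := fun hz => by
      have := hab 0 j
      rw [hz] at this
      simp at this
    rw [hm, mul_right_cancel₀ hne h]
  have hlin : Matrix.toEuclideanLin (pauliOp v) = star l • LinearMap.id := by
    refine b.toBasis.ext fun j => ?_
    ext i
    have := congrFun (hj j) i
    simpa using this
  apply Matrix.toEuclideanLin.injective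
  rw [hlin, map_smul]
  ext x i
  simp

/-! ### Spreads, unextendibility and the main theorem -/

/-- Nine pairwise disjoint Lagrangians cover the space. -/
theorem exists_mem_of_spread {W : Fin 9 → Submodule (ZMod 2) PauliIndex}
    (hW : ∀ k, IsLagrangian pauliForm (W k)) (hd : ∀ j k, j ≠ k → Disjoint (W j) (W k))
    {v : PauliIndex} (hv : v ≠ 0) : ∃ k, v ∈ W k := by
  have φ := fun k => ((hW k).exists_equiv isSymplecticSix_pauliForm).some
  let F : Fin 9 × {t : BinTriple // t ≠ 0} → {v : PauliIndex // v ≠ 0} := fun p =>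
    ⟨φ p.1 p.2, by simpa using p.2.2⟩
  have hF : Function.Injective F := by
    rintro ⟨j, s⟩ ⟨k, t⟩ h
    have h' : (φ j s : PauliIndex) = φ k t := congrArg Subtype.val h
    have hjk : j = k := by
      by_contra hjk
      have h0 := Submodule.disjoint_def.1 (hd j k hjk) _ (φ j s).2 (h' ▸ (φ k t).2)
      exact s.2 (by simpa using h0)
    subst hjk
    rw [Subtype.ext ((φ j).injective (Subtype.ext h'))]
  -- The count is `9 * 7 = 63 = 64 - 1`.
  have hcard : Fintype.card (Fin 9 × {t : BinTriple // t ≠ 0}) =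
      Fintype.card {v : PauliIndex // v ≠ 0} := by
    simp [Fintype.card_subtype_compl]
  obtain ⟨⟨k, t⟩, hkt⟩ := ((Fintype.bijective_iff_injective_and_card F).2 ⟨hF, hcard⟩).2 ⟨v, hv⟩
  refine ⟨k, ?_⟩
  have : (φ k t : PauliIndex) = v := congrArg Subtype.val hkt
  rw [← this]
  exact (φ k t).2

theorem isNewPauliClass_iff {κ : Type*} [Nonempty κ] {U : κ → Submodule (ZMod 2) PauliIndex}
    {T : Set (Matrix ThreeQubits ThreeQubits ℂ)} :
    IsNewPauliClass (fun k => pauliClass (U k)) T ↔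
      ∃ W, IsNewLagrangian pauliForm U W ∧ T = pauliClass W := by
  constructor
  · rintro ⟨hm, hs, hne⟩
    obtain ⟨W, hW, rfl⟩ := isMaximalCommutingClass_iff.1 hm
    exact ⟨W, ⟨hW, pauliClass_subset_iUnion.1 hs, fun k h => hne k (by rw [h])⟩, rfl⟩
  · rintro ⟨W, hW, rfl⟩
    exact ⟨hW.lagrangian.isMaximalCommutingClass, pauliClass_subset_iUnion.2 hW.covered,
      fun k h => hW.ne k (pauliClass_injective h)⟩

theorem isOperatorClasses_pauliClass {κ : Type*} {U : κ → Submodule (ZMod 2) PauliIndex}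
    (hU : ∀ k, IsLagrangian pauliForm (U k)) (hd : ∀ j k, j ≠ k → Disjoint (U j) (U k)) :
    IsOperatorClasses threeQubitPaulis (fun k => pauliClass (U k)) :=
  ⟨fun k => (hU k).isMaximalCommutingClass, fun j k h => disjoint_pauliClass_iff.2 (hd j k h)⟩

/-- Eigenbases of an unextendible set of Pauli classes are weakly unextendible. -/
theorem isWeaklyUnextendibleMUBs_of_lagrangians {κ : Type*}
    {U : κ → Submodule (ZMod 2) PauliIndex}
    (hU : ∀ k, IsLagrangian pauliForm (U k)) (hd : ∀ j k, j ≠ k → Disjoint (U j) (U k))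
    (hext : ∀ T, IsLagrangian pauliForm T → ∃ k, ¬ Disjoint T (U k))
    {B : κ → OrthonormalBasis ThreeQubits ℂ (EuclideanSpace ℂ ThreeQubits)}
    (hB : ∀ k, IsCommonEigenbasis (pauliClass (U k)) (B k)) :
    IsWeaklyUnextendibleMUBs threeQubitPaulis B := by
  refine ⟨fun j k h => areUnbiased_of_disjoint (hU j) (hU k) (hd j k h) (hB j) (hB k),
    ⟨_, isOperatorClasses_pauliClass hU hd, hB⟩, ?_⟩
  rintro ⟨T, b, hT, hb, hu⟩
  obtain ⟨W, hW, rfl⟩ := isMaximalCommutingClass_iff.1 hT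
  obtain ⟨k, hk⟩ := hext W hW
  exact hk (disjoint_of_areUnbiased hb (hB k) (hu k))

theorem isUnextendibleClasses_of_lagrangians {κ : Type*}
    {U : κ → Submodule (ZMod 2) PauliIndex}
    (hU : ∀ k, IsLagrangian pauliForm (U k)) (hd : ∀ j k, j ≠ k → Disjoint (U j) (U k))
    (hext : ∀ T, IsLagrangian pauliForm T → ∃ k, ¬ Disjoint T (U k)) :
    IsUnextendibleClasses threeQubitPaulis (fun k => pauliClass (U k)) := by
  refine ⟨isOperatorClasses_pauliClass hU hd, ?_⟩
  rintro ⟨T, hT, hsub⟩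
  obtain ⟨W, hW, rfl⟩ := isMaximalCommutingClass_iff.1 hT
  obtain ⟨k, hk⟩ := hext W hW
  rw [← disjoint_pauliClass_iff, Set.disjoint_left] at hk
  push Not at hk
  obtain ⟨P, hPW, hPU⟩ := hk
  exact (hsub hPW).2 (Or.inr (Set.mem_iUnion.2 ⟨k, hPU⟩))

theorem theorem3
    (C : Fin 9 → Set (Matrix ThreeQubits ThreeQubits ℂ))
    (hC : IsCompleteOperatorClasses threeQubitPaulis C) :
    ∃ S : Set (Matrix ThreeQubits ThreeQubits ℂ),
      -- exactly one new maximal commuting class can be formed from the first five classes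
      (IsNewPauliClass ![C 0, C 1, C 2, C 3, C 4] S ∧
        ∀ T, IsNewPauliClass ![C 0, C 1, C 2, C 3, C 4] T → T = S) ∧
      -- it forms an unextendible set of five classes with the four others
      IsUnextendibleClasses threeQubitPaulis ![C 5, C 6, C 7, C 8, S] ∧
      -- these five classes have common eigenbases
      (∀ k : Fin 5, ∃ b : OrthonormalBasis ThreeQubits ℂ (EuclideanSpace ℂ ThreeQubits),
        IsCommonEigenbasis (![C 5, C 6, C 7, C 8, S] k) b) ∧
      -- and any common eigenbases of them are five weakly unextendible MUBs
      ∀ B : Fin 5 → OrthonormalBasis ThreeQubits ℂ (EuclideanSpace ℂ ThreeQubits),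
        (∀ k : Fin 5, IsCommonEigenbasis (![C 5, C 6, C 7, C 8, S] k) (B k)) →
          IsWeaklyUnextendibleMUBs threeQubitPaulis B := by
  have hω := isSymplecticSix_pauliForm
  choose W hW hCW using fun k => isMaximalCommutingClass_iff.1 (hC.maximal k)
  have hd : ∀ j k, j ≠ k → Disjoint (W j) (W k) := fun j k h => by
    rw [← disjoint_pauliClass_iff, ← hCW, ← hCW]
    exact hC.disjoint j k h
  obtain rfl : C = fun k => pauliClass (W k) := funext hCW
  -- The uniqueness result needs the first five Lagrangians and one further member of the spread.
  let ι : Fin 6 → Fin 9 := Fin.castLE (by norm_num)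
  have hι : Function.Injective ι := Fin.castLE_injective _
  set U : Fin 5 → Submodule (ZMod 2) PauliIndex := fun k => W (ι k.castSucc) with hUdef
  have hUL : ∀ k, IsLagrangian pauliForm (U k) := fun k => hW _
  have hUd : ∀ j k, j ≠ k → Disjoint (U j) (U k) := fun j k h =>
    hd _ _ fun h' => h (Fin.castSucc_injective _ (hι h'))
  obtain ⟨S, hS, hSu⟩ := existsUnique_isNewLagrangian (U := fun k => W (ι k)) hω (fun k => hW _)
    (fun j k h => hd _ _ fun h' => h (hι h'))
  have hS : IsNewLagrangian pauliForm U S := hS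
  have hSu : ∀ T, IsNewLagrangian pauliForm U T → T = S := hSu
  have hD : ![pauliClass (W 0), pauliClass (W 1), pauliClass (W 2), pauliClass (W 3),
      pauliClass (W 4)] = fun k => pauliClass (U k) := by
    funext k; fin_cases k <;> rfl
  have hSW : ∀ k : Fin 9, 5 ≤ k.val → Disjoint (W k) S := fun k hk => by
    rw [Submodule.disjoint_def]
    intro v hvk hvS
    obtain ⟨j, hj⟩ := hS.covered v hvS
    refine Submodule.disjoint_def.1 (hd k _ fun h => ?_) v hvk hj
    rw [h] at hk
    have := j.2
    simp [ι] at hk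
    omega
  let Z : Fin 5 → Submodule (ZMod 2) PauliIndex := ![W 5, W 6, W 7, W 8, S]
  have hE : ![pauliClass (W 5), pauliClass (W 6), pauliClass (W 7), pauliClass (W 8),
      pauliClass S] = fun k => pauliClass (Z k) := by
    funext k; fin_cases k <;> rfl
  have hZL : ∀ k, IsLagrangian pauliForm (Z k) := by
    intro k
    fin_cases k
    exacts [hW 5, hW 6, hW 7, hW 8, hS.lagrangian]
  have hZd : ∀ j k, j ≠ k → Disjoint (Z j) (Z k) := by
    intro j k hjk
    fin_cases j <;> fin_cases k <;>
      first
      | exact absurd rfl hjk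
      | exact hd _ _ (by decide)
      | exact hSW _ (by decide)
      | exact (hSW _ (by decide)).symm
  have hext : ∀ T, IsLagrangian pauliForm T → ∃ k, ¬ Disjoint T (Z k) := by
    intro T hT
    by_contra! hTd
    -- The spread covers everything, so avoiding its last four members forces `T` into the first
    -- five.
    have hcov : ∀ v ∈ T, ∃ k, v ∈ U k := by
      intro v hv
      by_cases h0 : v = 0
      · exact ⟨0, h0 ▸ (U 0).zero_mem⟩
      obtain ⟨k, hk⟩ := exists_mem_of_spread hW hd h0
      have hnot : ∀ j, v ∉ Z j := fun j hj => h0 (Submodule.disjoint_def.1 (hTd j) v hv hj)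
      fin_cases k
      exacts [⟨0, hk⟩, ⟨1, hk⟩, ⟨2, hk⟩, ⟨3, hk⟩, ⟨4, hk⟩, absurd hk (hnot 0), absurd hk (hnot 1),
        absurd hk (hnot 2), absurd hk (hnot 3)]
    have hTS : ∀ v ∈ S, v ∈ T → v = 0 := fun v hvS hvT =>
      Submodule.disjoint_def.1 (hTd 4) v hvT hvS
    -- Either `T` is new and equals `S`, or it is one of the five, each of which meets `S`. Both
    -- contradict disjointness from `S`.
    by_cases hne : ∀ k, T ≠ U k
    · have h := hSu T ⟨hT, hcov, hne⟩
      obtain ⟨v, hvS, -, hv0⟩ := hS.exists_ne_zero hω hUL hUd 0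
      exact hv0 (hTS v hvS (h ▸ hvS))
    · push Not at hne
      obtain ⟨k, rfl⟩ := hne
      obtain ⟨v, hvS, hvk, hv0⟩ := hS.exists_ne_zero hω hUL hUd k
      exact hv0 (hTS v hvS hvk)
  refine ⟨pauliClass S, ?_, ?_, ?_, ?_⟩
  · rw [hD]
    refine ⟨isNewPauliClass_iff.2 ⟨S, hS, rfl⟩, fun T hT => ?_⟩
    obtain ⟨T, hTL, rfl⟩ := isNewPauliClass_iff.1 hT
    rw [hSu T hTL]
  · rw [hE]
    exact isUnextendibleClasses_of_lagrangians hZL hZd hext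
  · rw [hE]
    intro k
    refine exists_isCommonEigenbasis ?_ (hZL k).isMaximalCommutingClass.commute
    rintro _ ⟨v, -, rfl⟩
    exact pauliOp_isHermitian v
  · rw [hE]
    intro B hB
    exact isWeaklyUnextendibleMUBs_of_lagrangians hZL hZd hext hB
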